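/- There is a numerical constant $C>0$ such that the following holds. Let $m,n\ge 1$, let $\mathcal S$ be the set of all nonnegatively definite Hermitian $m\times m$ matrices of trace $1$ (states), and let $\|\cdot\|$ be the operator norm. Let $X,X_1,\dots,X_n$ be i.i.d. random Hermitian $m\times m$ matrices with distribution $\Pi$ and $\|X\|\le U$ a.s. for a constant $U>0$, and let $\xi,\xi_1,\dots,\xi_n$ be i.i.d. real random variables, independent of $(X_1,\dots,X_n)$, with ${\mathbb E}\xi=0$ and $|\xi|\le c_\xi$ a.s. for a constant $c_\xi>0$. For a state $\rho\in\mathcal S$ put $Y_j={\rm tr}(\rho X_j)+\xi_j$, and for $\varepsilon\ge0$ let $\hat\rho^\varepsilon$ be any minimizer over $S\in\mathcal S$ of $$\frac1n\sum_{j=1}^n\bigl(Y_j-{\rm tr}(SX_j)\bigr)^2+\varepsilon\,{\rm tr}(S\log S),\qquad 0\log 0=0,$$ where $\varepsilon=0$ gives the unpenalized least squares estimator. Denote $\|A\|_{L_2(\Pi)}^2={\mathbb E}|{\rm tr}(AX^*)|^2$, $\sigma_\xi^2={\mathbb E}\xi^2$, $\sigma_X^2=\|{\mathbb E}(X-{\mathbb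 E}X)^2\|$, $\sigma_{X\otimes X}^2=\|{\mathbb E}(X\otimes X-{\mathbb E}(X\otimes X))^2\|$, $t_m=t+\log(2m)$ for $t>0$, and $\Gamma=\frac{m({\mathbb E}\|X\|^2)^{1/2}}{\sqrt\varepsilon}\vee m$; put $\|\log S\|=+\infty$ if $S\in\mathcal S$ is not of full rank, and read $\varepsilon(\|\log S\|\wedge\log\Gamma)$ as $0$ for $\varepsilon=0$. Then for all $m,n$, $\Pi$, $U$, all noise distributions and $c_\xi$ as above, all $\rho\in\mathcal S$, $\varepsilon\ge0$, $t>0$ and all $S\in\mathcal S$, with probability at least $1-e^{-t}$ both $\|\hat\rho^\varepsilon-S\|_{L_2(\Pi)}^2$ and $\|\hat\rho^\varepsilon-\rho\|_{L_2(\Pi)}^2$ are at most $$\|S-\rho\|_{L_2(\Pi)}^2+C\Bigl[\varepsilon(\|\log S\|\wedge\log\Gamma)\vee\|S-\rho\|_{L_2(\Pi)}U\sqrt{\tfrac{t_m}{n}}\vee(\sigma_\xi\sigma_X\vee\sigma_\xi\|{\mathbb E}X\|\vee\sigma_{X\otimes X})\sqrt{\tfrac{t_m}{n}}\vee(c_\xi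 U\vee U^2)\tfrac{t_m}{n}\Bigr].$$ In particular, with probability at least $1-e^{-t}$, $$\|\hat\rho^\varepsilon-\rho\|_{L_2(\Pi)}^2\le C\Bigl[\varepsilon(\|\log\rho\|\wedge\log\Gamma)\vee(\sigma_\xi\sigma_X\vee\sigma_\xi\|{\mathbb E}X\|\vee\sigma_{X\otimes X})\sqrt{\tfrac{t_m}{n}}\vee(c_\xi U\vee U^2)\tfrac{t_m}{n}\Bigr].$$ -/

import Mathlib

open MeasureTheory ProbabilityTheory
open scoped Matrix Kronecker Matrix.Norms.L2Operator ComplexOrder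

/-- Complex matrices carry their Borel σ-algebra. -/
noncomputable instance instMeasurableSpaceComplexMatrix {m : ℕ} :
    MeasurableSpace (Matrix (Fin m) (Fin m) ℂ) := borel _

instance instBorelSpaceComplexMatrix {m : ℕ} :
    BorelSpace (Matrix (Fin m) (Fin m) ℂ) := ⟨rfl⟩

namespace EntropyTomography

noncomputable section

variable {m : ℕ}

/-- The set of states (density matrices): nonnegatively definite Hermitian matrices of trace one. -/
def states (m : ℕ) : Set (Matrix (Fin m) (Fin m) ℂ) :=
  {S | S.PosSemidef ∧ S.trace = 1}

/-- The logarithm of a Hermitian matrix, by functional calculus. On a singular matrix the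
eigenvalue `0` is sent to `0`, so that `S * matLog S` follows the convention `0 log 0 = 0`. -/
def matLog (S : Matrix (Fin m) (Fin m) ℂ) : Matrix (Fin m) (Fin m) ℂ :=
  cfc Real.log S

/-- The Hilbert-Schmidt inner product `⟨A, B⟩ = tr (A B*)`. -/
def hsInner (A B : Matrix (Fin m) (Fin m) ℂ) : ℂ := (A * Bᴴ).trace

/-- The objective `n⁻¹ ∑ⱼ (yⱼ - tr (S xⱼ))² + ε tr (S log S)`; the traces are real for
Hermitian `S` and `xⱼ`. -/
def empiricalObjective {n : ℕ} (x : Fin n → Matrix (Fin m) (Fin m) ℂ) (y : Fin n → ℝ) (ε : ℝ)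
    (S : Matrix (Fin m) (Fin m) ℂ) : ℝ :=
  (n : ℝ)⁻¹ * ∑ j, (y j - (S * x j).trace.re) ^ 2 + ε * (S * matLog S).trace.re

/-- `R` is a penalized least squares solution: it minimizes the objective over all states. -/
def IsEstimate {n : ℕ} (x : Fin n → Matrix (Fin m) (Fin m) ℂ) (y : Fin n → ℝ) (ε : ℝ)
    (R : Matrix (Fin m) (Fin m) ℂ) : Prop :=
  R ∈ states m ∧ IsMinOn (empiricalObjective x y ε) (states m) R

/-- The `L₂(Q)` norm of a matrix, `(𝔼 |⟨A, X⟩|²)^{1/2}` with `X` of law `Q`. -/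
def l2Norm (Q : Measure (Matrix (Fin m) (Fin m) ℂ)) (A : Matrix (Fin m) (Fin m) ℂ) : ℝ :=
  √(∫ x, ‖hsInner A x‖ ^ 2 ∂Q)

/-- The mean `𝔼 X`. -/
def meanX (Q : Measure (Matrix (Fin m) (Fin m) ℂ)) : Matrix (Fin m) (Fin m) ℂ :=
  ∫ x, x ∂Q

/-- `σ_X = ‖𝔼 (X - 𝔼 X)²‖^{1/2}`, in operator norm. -/
def sigmaX (Q : Measure (Matrix (Fin m) (Fin m) ℂ)) : ℝ :=
  √‖∫ x, (x - meanX Q) ^ 2 ∂Q‖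

/-- The mean `𝔼 (X ⊗ X)`. -/
def meanXX (Q : Measure (Matrix (Fin m) (Fin m) ℂ)) :
    Matrix (Fin m × Fin m) (Fin m × Fin m) ℂ :=
  ∫ x, x ⊗ₖ x ∂Q

/-- `σ_{X ⊗ X} = ‖𝔼 (X ⊗ X - 𝔼 (X ⊗ X))²‖^{1/2}`, in operator norm. -/
def sigmaXX (Q : Measure (Matrix (Fin m) (Fin m) ℂ)) : ℝ :=
  √‖∫ x, (x ⊗ₖ x - meanXX Q) ^ 2 ∂Q‖

/-- `σ_ξ = (𝔼 ξ²)^{1/2}`. -/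
def sigmaXi (ν : Measure ℝ) : ℝ := √(∫ u, u ^ 2 ∂ν)

/-- `t_m = t + log (2m)`. -/
def tm (m : ℕ) (t : ℝ) : ℝ := t + Real.log (2 * m)

/-- `Γ = m (𝔼 ‖X‖²)^{1/2} / √ε ∨ m`, for `ε > 0`. -/
def Gam (Q : Measure (Matrix (Fin m) (Fin m) ℂ)) (ε : ℝ) : ℝ :=
  max (m * √(∫ x, ‖x‖ ^ 2 ∂Q) / √ε) m

open Classical in
/-- `ε (‖log S‖ ∧ log Γ)`, where `‖log S‖ = +∞` if the state `S` is not of full rank. For `ε = 0`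
the value is `0`. -/
def penaltyTerm (Q : Measure (Matrix (Fin m) (Fin m) ℂ)) (ε : ℝ)
    (S : Matrix (Fin m) (Fin m) ℂ) : ℝ :=
  ε * (if S.PosDef then min ‖matLog S‖ (Real.log (Gam Q ε)) else Real.log (Gam Q ε))

/-- `(σ_ξ σ_X ∨ σ_ξ ‖𝔼 X‖ ∨ σ_{X ⊗ X}) √(t_m / n)`. -/
def noiseTerm (Q : Measure (Matrix (Fin m) (Fin m) ℂ)) (ν : Measure ℝ) (n : ℕ) (t : ℝ) : ℝ :=
  max (max (sigmaXi ν * sigmaX Q) (sigmaXi ν * ‖meanX Q‖)) (sigmaXX Q) * √(tm m t / n)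

/-- `(c_ξ U ∨ U²) t_m / n`. -/
def boundTerm (m : ℕ) (c U : ℝ) (n : ℕ) (t : ℝ) : ℝ :=
  max (c * U) (U ^ 2) * (tm m t / n)

end

end EntropyTomography

/-!
The estimator is controlled by two random matrices, the noise average `N = n⁻¹ ∑ ξⱼ Xⱼ` and the
design fluctuation `D = n⁻¹ ∑ (Xⱼ ⊗ Xⱼ - 𝔼 (X ⊗ X))`.

The deterministic half is `IsEstimate.oracle_inequality`. The objective is a quadratic plus `ε` times
a convex function (`re_trace_mul_matLog_convex`, by Peierls' inequality), so a minimizer `R` gains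
the full squared empirical distance: `‖R - S‖²ₙ + L(R) ≤ L(S)` for every state `S`. Expanding the
squares leaves the cross term `2 tr ((R - S) N) ≤ 4 ‖N‖`, by trace duality, and the entropy
difference, at most `ε log m`. The logarithm is absorbed by the penalty term: the least eigenvalue
of a state is at most `1 / m`, so `‖log S‖ ≥ log m`, and `Γ ≥ m`. Finally, for a difference `A` of
states, `‖A‖²ₙ - ‖A‖²_{L₂(Π)} = tr ((A ⊗ A) D)` is at most `4 ‖D‖` in absolute value, as `A ⊗ A` is
a signed sum of four states.

The probabilistic half bounds `‖N‖` and `‖D‖` by `matrix_bernstein`. In the i.i.d. case the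
Ahlswede–Winter form, which peels off one summand of the trace exponential moment at a time by
`golden_thompson`, already has the sharp variance. Golden–Thompson follows from the Lie product
formula and the inequality `|tr (PQ)^N| ≤ tr (P^N Q^N)` for powers of two `N`
(`norm_trace_pow_le`).
-/

namespace EntropyTomography

/-! ### The Golden–Thompson inequality -/

section GoldenThompson

variable {d : Type*} [Fintype d]

lemma re_trace_mul_conjTranspose_self (A : Matrix d d ℂ) :
    (A * Aᴴ).trace.re = ∑ p : d × d, ‖A p.1 p.2‖ ^ 2 := by
  simp only [Matrix.trace, Matrix.diag, Matrix.mul_apply, Matrix.conjTranspose_apply,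
    Fintype.sum_prod_type, Complex.re_sum]
  refine Finset.sum_congr rfl fun i _ => Finset.sum_congr rfl fun j _ => ?_
  rw [Complex.star_def, Complex.mul_conj, Complex.normSq_eq_norm_sq, Complex.ofReal_re]

/-- Cauchy–Schwarz for the Hilbert–Schmidt inner product. -/
lemma sq_norm_trace_mul_le (A B : Matrix d d ℂ) :
    ‖(A * B).trace‖ ^ 2 ≤ (A * Aᴴ).trace.re * (Bᴴ * B).trace.re := by
  have hB : (Bᴴ * B).trace.re = ∑ p : d × d, ‖B p.2 p.1‖ ^ 2 := by
    have := re_trace_mul_conjTranspose_self Bᴴ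
    simpa using this
  rw [re_trace_mul_conjTranspose_self, hB]
  refine le_trans ?_ (Finset.sum_mul_sq_le_sq_mul_sq _ _ _)
  gcongr
  calc ‖(A * B).trace‖ = ‖∑ p : d × d, A p.1 p.2 * B p.2 p.1‖ := by
        simp [Matrix.trace, Matrix.mul_apply, Fintype.sum_prod_type]
    _ ≤ ∑ p : d × d, ‖A p.1 p.2‖ * ‖B p.2 p.1‖ :=
        (norm_sum_le _ _).trans_eq (by simp)

variable [DecidableEq d]

lemma trace_mul_pow_comm (A B : Matrix d d ℂ) (k : ℕ) :
    ((A * B) ^ k).trace = ((B * A) ^ k).trace := by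
  rcases k with _ | k
  · simp
  · rw [pow_succ', mul_assoc, Matrix.trace_mul_comm, mul_assoc, pow_succ']
    congr 1
    have h : B * (A * B) ^ k = (B * A) ^ k * B := by
      induction k with
      | zero => simp
      | succ k ih => rw [pow_succ, ← mul_assoc, ih, pow_succ]; simp only [mul_assoc]
    rw [← mul_assoc, h, mul_assoc, ← pow_succ, ← pow_succ']

lemma trace_mul_nonneg {A B : Matrix d d ℂ} (hA : A.PosSemidef) (hB : B.PosSemidef) :
    0 ≤ (A * B).trace := by
  obtain ⟨C, rfl⟩ : ∃ C : Matrix d d ℂ, B = Cᴴ * C := by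
    open scoped MatrixOrder in
    exact CStarAlgebra.nonneg_iff_eq_star_mul_self.mp (Matrix.nonneg_iff_posSemidef.mpr hB)
  rw [← mul_assoc, Matrix.trace_mul_comm, ← mul_assoc]
  exact (hA.mul_mul_conjTranspose_same C).trace_nonneg

/-- The inequalities `|tr (PQ)^N| ≤ tr (P^N Q^N)`, for positive semidefinite `P` and `Q`, and
`|tr M^{2N}| ≤ tr (M* M)^N`, for `N = 2^k`. They are proved by a joint induction: the second one
for `M = PQ` turns `(PQ)^{2N}` into `(P² Q²)^N`, and the first one for `P = M* M`, `Q = M M*`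
separates the factors of `(M²)* M²`. -/
lemma norm_trace_pow_le (k : ℕ) :
    (∀ P Q : Matrix d d ℂ, P.PosSemidef → Q.PosSemidef →
      ‖((P * Q) ^ 2 ^ k).trace‖ ≤ (P ^ 2 ^ k * Q ^ 2 ^ k).trace.re) ∧
    ∀ M : Matrix d d ℂ, ‖(M ^ 2 ^ (k + 1)).trace‖ ≤ ((Mᴴ * M) ^ 2 ^ k).trace.re := by
  induction k with
  | zero =>
    refine ⟨fun P Q hP hQ => ?_, fun M => ?_⟩
    · have h := trace_mul_nonneg hP hQ
      simp only [pow_zero, pow_one]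
      rw [Complex.le_def] at h
      exact (Complex.abs_re_eq_norm.mpr h.2.symm).symm.le.trans_eq (abs_of_nonneg h.1)
    · have h := sq_norm_trace_mul_le M M
      rw [Matrix.trace_mul_comm M Mᴴ, ← sq, ← sq] at h
      have h0 : 0 ≤ (Mᴴ * M).trace.re :=
        (Complex.le_def.mp (Matrix.posSemidef_conjTranspose_mul_self M).trace_nonneg).1
      simpa [pow_two] using abs_le_of_sq_le_sq h h0
  | succ k ih =>
    obtain ⟨hG, hH⟩ := ih
    have key : ∀ P Q : Matrix d d ℂ, P.PosSemidef → Q.PosSemidef →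
      ‖((P * Q) ^ 2 ^ (k + 1)).trace‖ ≤ (P ^ 2 ^ (k + 1) * Q ^ 2 ^ (k + 1)).trace.re := by
      intro P Q hP hQ
      refine (hH (P * Q)).trans ?_
      have e : ((P * Q)ᴴ * (P * Q)) = Q * (P ^ 2 * Q) := by
        rw [Matrix.conjTranspose_mul, hP.1.eq, hQ.1.eq]; simp only [pow_two, mul_assoc]
      rw [e, trace_mul_pow_comm, mul_assoc, ← pow_two]
      refine (Complex.re_le_norm _).trans ((hG _ _ (hP.pow 2) (hQ.pow 2)).trans_eq ?_)
      rw [← pow_mul, ← pow_mul, pow_succ' 2 k]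
    refine ⟨key, fun M => ?_⟩
    have h1 := hH (M ^ 2)
    rw [← pow_mul, ← pow_succ'] at h1
    refine h1.trans ?_
    have e : (M ^ 2)ᴴ * M ^ 2 = Mᴴ * (Mᴴ * M * M) := by
      simp only [pow_two, Matrix.conjTranspose_mul, mul_assoc]
    rw [e, trace_mul_pow_comm, mul_assoc]
    have hP := Matrix.posSemidef_conjTranspose_mul_self M
    have hQ := Matrix.posSemidef_self_mul_conjTranspose M
    refine (Complex.re_le_norm _).trans ((hG _ _ hP hQ).trans ?_)
    have hcs := sq_norm_trace_mul_le ((Mᴴ * M) ^ 2 ^ k) ((M * Mᴴ) ^ 2 ^ k)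
    rw [(hP.pow _).1.eq, (hQ.pow _).1.eq, ← pow_add, ← pow_add, ← two_mul, ← pow_succ',
      trace_mul_pow_comm M Mᴴ, ← sq] at hcs
    have h0 : 0 ≤ ((Mᴴ * M) ^ 2 ^ (k + 1)).trace.re :=
      (Complex.le_def.mp (hP.pow _).trace_nonneg).1
    exact (Complex.re_le_norm _).trans (by simpa using abs_le_of_sq_le_sq hcs h0)

lemma l2_opNorm_pow_le (A : Matrix d d ℂ) (N : ℕ) : ‖A ^ N‖ ≤ ‖A‖ ^ N := by
  rcases N with _ | N
  · rcases isEmpty_or_nonempty d with hd | hd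
    · rw [Subsingleton.elim (A ^ 0) 0]; simp
    · simp
  · exact norm_pow_le' A N.succ_pos

open NormedSpace in
lemma l2_opNorm_exp_le (A : Matrix d d ℂ) : ‖exp A‖ ≤ Real.exp ‖A‖ := by
  rw [exp_eq_tsum ℝ, Real.exp_eq_exp_ℝ, exp_eq_tsum ℝ]
  refine tsum_of_norm_bounded (expSeries_summable' (𝕂 := ℝ) ‖A‖).hasSum fun k => ?_
  rw [norm_smul, smul_eq_mul, Real.norm_of_nonneg (by positivity)]
  gcongr
  exact l2_opNorm_pow_le A k

open NormedSpace in
/-- The Lie product formula. -/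
lemma tendsto_exp_mul_exp_pow (A B : Matrix d d ℂ) :
    Filter.Tendsto (fun N : ℕ => (exp ((N : ℝ)⁻¹ • A) * exp ((N : ℝ)⁻¹ • B)) ^ N)
      Filter.atTop (nhds (exp (A + B))) := by
  set F : ℝ → Matrix d d ℂ := fun s => exp (s • A) * exp (s • B) - exp (s • (A + B)) with hF
  have hd : HasDerivAt F 0 0 := by
    have hA := hasDerivAt_exp_smul_const (𝕂 := ℝ) A 0
    have hB := hasDerivAt_exp_smul_const (𝕂 := ℝ) B 0
    have hAB := hasDerivAt_exp_smul_const (𝕂 := ℝ) (A + B) 0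
    have := (hA.mul hB).sub hAB
    simpa [hF, Pi.sub_def, Pi.mul_def, smul_add] using! this
  -- hence `N * F (1/N) → 0`
  have h1 : Filter.Tendsto (fun N : ℕ => (N : ℝ) * ‖F (N : ℝ)⁻¹‖) Filter.atTop (nhds 0) := by
    have h := hasDerivAt_iff_tendsto.mp hd
    have h2 : Filter.Tendsto (fun N : ℕ => ((N : ℝ))⁻¹) Filter.atTop (nhds 0) :=
      tendsto_inv_atTop_zero.comp tendsto_natCast_atTop_atTop
    have h3 := h.comp h2
    refine h3.congr fun N => ?_
    simp [hF]
  -- telescoping: `‖a^N - b^N‖ ≤ N ‖a - b‖ c^(N-1)`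
  have tel : ∀ (a b : Matrix d d ℂ) (c : ℝ), 1 ≤ c → ‖a‖ ≤ c → ‖b‖ ≤ c → ∀ N : ℕ,
      ‖a ^ N - b ^ N‖ ≤ N * ‖a - b‖ * c ^ N := by
    intro a b c hc ha hb N
    induction N with
    | zero => simp
    | succ N ih =>
      have hbN : ‖b ^ N‖ ≤ c ^ N := (l2_opNorm_pow_le b N).trans (by gcongr)
      have e : a ^ (N + 1) - b ^ (N + 1) = a * (a ^ N - b ^ N) + (a - b) * b ^ N := by
        rw [pow_succ', pow_succ']; noncomm_ring
      rw [e]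
      calc _ ≤ ‖a‖ * ‖a ^ N - b ^ N‖ + ‖a - b‖ * ‖b ^ N‖ :=
            (norm_add_le _ _).trans (add_le_add (norm_mul_le _ _) (norm_mul_le _ _))
        _ ≤ c * (N * ‖a - b‖ * c ^ N) + ‖a - b‖ * (c ^ N * c) := by
            gcongr
            exact hbN.trans (le_mul_of_one_le_right (by positivity) hc)
        _ = _ := by push_cast; ring
  rw [tendsto_iff_norm_sub_tendsto_zero]
  set c := ‖A‖ + ‖B‖
  refine squeeze_zero' (g := fun N : ℕ => (N : ℝ) * ‖F (N : ℝ)⁻¹‖ * Real.exp c)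
    (Filter.Eventually.of_forall fun _ => norm_nonneg _) ?_ (by simpa using h1.mul_const _)
  filter_upwards [Filter.eventually_gt_atTop 0] with N hN
  have hN' : (0 : ℝ) < N := by exact_mod_cast hN
  have e1 : exp (A + B) = exp ((N : ℝ)⁻¹ • (A + B)) ^ N := by
    rw [← Matrix.exp_nsmul, ← Nat.cast_smul_eq_nsmul ℝ, smul_smul, mul_inv_cancel₀ hN'.ne',
      one_smul]
  have e2 : Real.exp c = Real.exp ((N : ℝ)⁻¹ * c) ^ N := by
    rw [← Real.exp_nat_mul]; congr 1; field_simp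
  rw [e1, e2]
  refine tel _ _ _ (Real.one_le_exp (by positivity)) ?_ ?_ N
  · refine (norm_mul_le _ _).trans ?_
    rw [mul_add, Real.exp_add]
    have : ∀ C : Matrix d d ℂ, ‖exp ((N : ℝ)⁻¹ • C)‖ ≤ Real.exp ((N : ℝ)⁻¹ * ‖C‖) := fun C =>
      (l2_opNorm_exp_le _).trans_eq (by rw [norm_smul]; simp)
    gcongr
    exacts [this A, this B]
  · refine (l2_opNorm_exp_le _).trans (Real.exp_le_exp.mpr ?_)
    rw [norm_smul]
    simp only [norm_inv, Real.norm_natCast]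
    gcongr
    exact norm_add_le _ _

open NormedSpace in
/-- The **Golden–Thompson inequality**. -/
theorem golden_thompson {A B : Matrix d d ℂ} (hA : A.IsHermitian) (hB : B.IsHermitian) :
    (exp (A + B)).trace.re ≤ (exp A * exp B).trace.re := by
  have hpos : ∀ C : Matrix d d ℂ, C.IsHermitian → (exp C).PosSemidef := by
    intro C hC
    have h2 : exp C = (exp ((2 : ℝ)⁻¹ • C)) * (exp ((2 : ℝ)⁻¹ • C))ᴴ := by
      rw [← Matrix.exp_conjTranspose, Matrix.conjTranspose_smul, hC.eq, star_trivial, ← pow_two,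
        ← Matrix.exp_nsmul, ← Nat.cast_smul_eq_nsmul ℝ, smul_smul]
      norm_num
    rw [h2]
    exact Matrix.posSemidef_self_mul_conjTranspose _
  have hs : ∀ (r : ℝ) (C : Matrix d d ℂ), C.IsHermitian → (r • C).IsHermitian := by
    intro r C hC
    rw [Matrix.IsHermitian, Matrix.conjTranspose_smul, hC.eq, star_trivial]
  have hlim := (tendsto_exp_mul_exp_pow A B).comp (tendsto_pow_atTop_atTop_of_one_lt one_lt_two)
  have hcont : Continuous fun M : Matrix d d ℂ => M.trace.re := by fun_prop
  refine le_of_tendsto ((hcont.tendsto _).comp hlim) (Filter.Eventually.of_forall fun k => ?_)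
  have h := (norm_trace_pow_le k).1 _ _ (hpos _ (hs ((2 ^ k : ℕ) : ℝ)⁻¹ A hA))
    (hpos _ (hs ((2 ^ k : ℕ) : ℝ)⁻¹ B hB))
  refine (Complex.re_le_norm _).trans (h.trans_eq ?_)
  have e : ∀ C : Matrix d d ℂ, exp (((2 ^ k : ℕ) : ℝ)⁻¹ • C) ^ 2 ^ k = exp C := by
    intro C
    rw [← Matrix.exp_nsmul, ← Nat.cast_smul_eq_nsmul ℝ, smul_smul, mul_inv_cancel₀ (by positivity),
      one_smul]
  rw [e, e]

end GoldenThompson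

/-! ### Spectral calculus, Peierls' inequality and trace bounds -/

section Spectral

variable {d : Type*} [Fintype d] [DecidableEq d]

lemma trace_cfc {A : Matrix d d ℂ} (hA : A.IsHermitian) (f : ℝ → ℝ) :
    (cfc f A).trace = ((∑ i, f (hA.eigenvalues i) : ℝ) : ℂ) := by
  rw [hA.cfc_eq, Matrix.IsHermitian.cfc, Unitary.conjStarAlgAut_apply, Matrix.trace_mul_comm,
    ← mul_assoc, Unitary.coe_star_mul_self, one_mul, Matrix.trace_diagonal]
  simp

lemma sum_eigenvalues {A : Matrix d d ℂ} (hA : A.IsHermitian) :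
    ∑ i, hA.eigenvalues i = A.trace.re := by
  have h := trace_cfc hA id
  rw [cfc_id ℝ A hA.isSelfAdjoint] at h
  simp [h]

/-- **Peierls' inequality**: by Jensen, since the diagonal entries of `V* A V` are averages of the
eigenvalues of `A` with doubly stochastic weights. -/
lemma sum_diag_le_trace_cfc {s : Set ℝ} {f : ℝ → ℝ} (hf : ConvexOn ℝ s f) {A : Matrix d d ℂ}
    (hA : A.IsHermitian) (hs : ∀ i, hA.eigenvalues i ∈ s)
    {V : Matrix d d ℂ} (hV : V ∈ Matrix.unitaryGroup d ℂ) :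
    (∀ i, ((Vᴴ * A * V) i i).re ∈ s) ∧
      ∑ i, f ((Vᴴ * A * V) i i).re ≤ (cfc f A).trace.re := by
  set W : Matrix d d ℂ := (star (hA.eigenvectorUnitary : Matrix d d ℂ)) * V with hW
  have hWmem : W ∈ Matrix.unitaryGroup d ℂ :=
    mul_mem (Unitary.star_mem hA.eigenvectorUnitary.2) hV
  have hentry : ∀ i, ((Vᴴ * A * V) i i).re = ∑ j, ‖W j i‖ ^ 2 • hA.eigenvalues j := by
    intro i
    have e : Vᴴ * A * V = Wᴴ * Matrix.diagonal (fun j => (hA.eigenvalues j : ℂ)) * W := by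
      conv_lhs => rw [hA.spectral_theorem]
      rw [Unitary.conjStarAlgAut_apply, hW]
      simp only [← Matrix.star_eq_conjTranspose, star_mul, star_star, mul_assoc]
      rfl
    rw [e, Matrix.mul_apply, Complex.re_sum]
    refine Finset.sum_congr rfl fun j _ => ?_
    rw [Matrix.mul_diagonal, Matrix.conjTranspose_apply, mul_right_comm, Complex.star_def,
      mul_comm (starRingEnd ℂ _), Complex.mul_conj, Complex.normSq_eq_norm_sq,
      ← Complex.ofReal_mul, Complex.ofReal_re, smul_eq_mul]
  have hcol : ∀ i, ∑ j, ‖W j i‖ ^ 2 = 1 := by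
    intro i
    have h := congrFun (congrFun (Matrix.mem_unitaryGroup_iff'.mp hWmem) i) i
    rw [Matrix.mul_apply, Matrix.one_apply_eq] at h
    have h' := congrArg Complex.re h
    rw [Complex.re_sum, Complex.one_re] at h'
    rw [← h']
    refine Finset.sum_congr rfl fun j _ => ?_
    rw [Matrix.star_apply, Complex.star_def, mul_comm, Complex.mul_conj,
      Complex.normSq_eq_norm_sq, Complex.ofReal_re]
  have hrow : ∀ j, ∑ i, ‖W j i‖ ^ 2 = 1 := by
    intro i
    have h := congrFun (congrFun (Matrix.mem_unitaryGroup_iff.mp hWmem) i) i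
    rw [Matrix.mul_apply, Matrix.one_apply_eq] at h
    have h' := congrArg Complex.re h
    rw [Complex.re_sum, Complex.one_re] at h'
    rw [← h']
    refine Finset.sum_congr rfl fun j _ => ?_
    rw [Matrix.star_apply, Complex.star_def, Complex.mul_conj,
      Complex.normSq_eq_norm_sq, Complex.ofReal_re]
  refine ⟨fun i => ?_, ?_⟩
  · rw [hentry]
    exact hf.1.sum_mem (fun _ _ => by positivity) (hcol i) fun j _ => hs j
  · rw [trace_cfc hA, Complex.ofReal_re]
    calc ∑ i, f ((Vᴴ * A * V) i i).re
        ≤ ∑ i, ∑ j, ‖W j i‖ ^ 2 • f (hA.eigenvalues j) := by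
          refine Finset.sum_le_sum fun i _ => ?_
          rw [hentry]
          exact hf.map_sum_le (fun _ _ => by positivity) (hcol i) fun j _ => hs j
      _ = ∑ j, f (hA.eigenvalues j) := by
          rw [Finset.sum_comm]
          refine Finset.sum_congr rfl fun j _ => ?_
          rw [← Finset.sum_smul, hrow, one_smul]

/-- The trace function `A ↦ tr f(A)` of a convex `f` is convex. -/
lemma trace_cfc_convex {s : Set ℝ} {f : ℝ → ℝ} (hf : ConvexOn ℝ s f) {A B : Matrix d d ℂ}
    (hA : A.IsHermitian) (hB : B.IsHermitian) (hsA : ∀ i, hA.eigenvalues i ∈ s)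
    (hsB : ∀ i, hB.eigenvalues i ∈ s) {a b : ℝ} (ha : 0 ≤ a) (hb : 0 ≤ b) (hab : a + b = 1) :
    (cfc f (a • A + b • B)).trace.re ≤ a * (cfc f A).trace.re + b * (cfc f B).trace.re := by
  have hC : (a • A + b • B).IsHermitian :=
    (hA.smul (IsSelfAdjoint.all a)).add (hB.smul (IsSelfAdjoint.all b))
  set V : Matrix d d ℂ := (hC.eigenvectorUnitary : Matrix d d ℂ)
  have hV : V ∈ Matrix.unitaryGroup d ℂ := hC.eigenvectorUnitary.2
  obtain ⟨hA1, hA2⟩ := sum_diag_le_trace_cfc hf hA hsA hV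
  obtain ⟨hB1, hB2⟩ := sum_diag_le_trace_cfc hf hB hsB hV
  rw [trace_cfc hC, Complex.ofReal_re]
  have e : ∀ i, hC.eigenvalues i = a • ((Vᴴ * A * V) i i).re + b • ((Vᴴ * B * V) i i).re := by
    intro i
    have h1 : Vᴴ * (a • A + b • B) * V
        = Matrix.diagonal (fun j => (hC.eigenvalues j : ℂ)) := by
      conv_lhs => rw [hC.spectral_theorem]
      rw [Unitary.conjStarAlgAut_apply, ← Matrix.star_eq_conjTranspose]
      have h2 : star V * V = 1 := Matrix.mem_unitaryGroup_iff'.mp hV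
      change star V * (V * _ * star V) * V = _
      rw [mul_assoc V, ← mul_assoc (star V), h2, one_mul, mul_assoc, h2, mul_one]
      rfl
    have h3 := congrArg Complex.re (congrFun (congrFun h1 i) i)
    rw [Matrix.diagonal_apply_eq, Complex.ofReal_re] at h3
    rw [← h3, mul_add, add_mul, Matrix.add_apply, Complex.add_re]
    simp
  calc ∑ i, f (hC.eigenvalues i)
      ≤ ∑ i, (a * f ((Vᴴ * A * V) i i).re + b * f ((Vᴴ * B * V) i i).re) := by
        refine Finset.sum_le_sum fun i _ => ?_
        rw [e]
        exact hf.2 (hA1 i) (hB1 i) ha hb hab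
    _ = a * ∑ i, f ((Vᴴ * A * V) i i).re + b * ∑ i, f ((Vᴴ * B * V) i i).re := by
        rw [Finset.sum_add_distrib, Finset.mul_sum, Finset.mul_sum]
    _ ≤ _ := by gcongr

lemma posSemidef_cfc {A : Matrix d d ℂ} {f : ℝ → ℝ}
    (hf : ∀ x ∈ spectrum ℝ A, 0 ≤ f x) : (cfc f A).PosSemidef := by
  open scoped MatrixOrder in
  exact Matrix.nonneg_iff_posSemidef.mp (cfc_nonneg hf)

lemma abs_le_norm_of_mem_spectrum {A : Matrix d d ℂ} (hA : A.IsHermitian) {x : ℝ}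
    (hx : x ∈ spectrum ℝ A) : |x| ≤ ‖A‖ := by
  simpa [cfc_id ℝ A hA.isSelfAdjoint] using
    norm_apply_le_norm_cfc (id : ℝ → ℝ) A hx (ha := hA.isSelfAdjoint)

open NormedSpace in
lemma posSemidef_exp {A : Matrix d d ℂ} (hA : A.IsHermitian) : (exp A).PosSemidef := by
  rw [← CFC.real_exp_eq_normedSpace_exp (a := A) hA]
  exact posSemidef_cfc fun x _ => (Real.exp_pos x).le

open NormedSpace in
/-- The operator inequality `exp A ≤ 1 + A + A²` for `‖A‖ ≤ 1`. -/
lemma posSemidef_sub_exp {A : Matrix d d ℂ} (hA : A.IsHermitian) (h1 : ‖A‖ ≤ 1) :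
    (1 + A + A ^ 2 - exp A).PosSemidef := by
  have hA' : IsSelfAdjoint A := hA
  have e : 1 + A + A ^ 2 - exp A = cfc (fun x : ℝ => 1 + x + x ^ 2 - Real.exp x) A := by
    rw [cfc_sub _ _ A, cfc_add .., cfc_add .., cfc_const_one ℝ A, cfc_id' ℝ A, cfc_pow_id A 2,
      CFC.real_exp_eq_normedSpace_exp]
  rw [e]
  refine posSemidef_cfc fun x hx => ?_
  have hx1 : |x| ≤ 1 := (abs_le_norm_of_mem_spectrum hA hx).trans h1
  have h := Real.abs_exp_sub_one_sub_id_le hx1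
  linarith [le_abs_self (Real.exp x - 1 - x)]

lemma re_trace_mul_mono {P A B : Matrix d d ℂ} (hP : P.PosSemidef) (hAB : (B - A).PosSemidef) :
    (P * A).trace.re ≤ (P * B).trace.re := by
  have h := (Complex.le_def.mp (trace_mul_nonneg hP hAB)).1
  rw [mul_sub, Matrix.trace_sub, Complex.sub_re] at h
  simpa using h

lemma re_trace_mul_le_norm {P A : Matrix d d ℂ} (hP : P.PosSemidef) (hA : A.IsHermitian) :
    (P * A).trace.re ≤ P.trace.re * ‖A‖ := by
  have h : (algebraMap ℝ (Matrix d d ℂ) ‖A‖ - A).PosSemidef := by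
    open scoped MatrixOrder in
    exact Matrix.le_iff.mp (IsSelfAdjoint.le_algebraMap_norm_self (a := A) hA)
  refine (re_trace_mul_mono hP h).trans_eq ?_
  rw [Algebra.algebraMap_eq_smul_one, mul_smul_comm, mul_one, Matrix.trace_smul, Complex.smul_re,
    smul_eq_mul, mul_comm]

/-- Duality of the trace norm and the operator norm, for a positive semidefinite `P`. -/
lemma abs_re_trace_mul_le_norm {P A : Matrix d d ℂ} (hP : P.PosSemidef) (hA : A.IsHermitian) :
    |(P * A).trace.re| ≤ P.trace.re * ‖A‖ := by
  refine abs_le'.mpr ⟨re_trace_mul_le_norm hP hA, ?_⟩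
  simpa using re_trace_mul_le_norm hP hA.neg

open NormedSpace in
/-- The norm of a Hermitian matrix is the largest eigenvalue of `A` or of `-A`; this turns a bound
on trace exponential moments into a tail bound for the norm. -/
lemma exp_norm_le_trace_exp [Nonempty d] {A : Matrix d d ℂ} (hA : A.IsHermitian) :
    Real.exp ‖A‖ ≤ (exp A).trace.re + (exp (-A)).trace.re := by
  have hA' : IsSelfAdjoint A := hA
  have e1 : (exp A).trace.re = ∑ i, Real.exp (hA.eigenvalues i) := by
    rw [← CFC.real_exp_eq_normedSpace_exp (a := A), trace_cfc hA, Complex.ofReal_re]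
  have e2 : (exp (-A)).trace.re = ∑ i, Real.exp (-hA.eigenvalues i) := by
    rw [← CFC.real_exp_eq_normedSpace_exp (a := -A) hA'.neg, ← cfc_comp_neg _ A, trace_cfc hA,
      Complex.ofReal_re]
  have key : ∀ i, Real.exp |hA.eigenvalues i| ≤ (exp A).trace.re + (exp (-A)).trace.re := by
    intro i
    rw [e1, e2, ← Finset.sum_add_distrib]
    refine le_trans ?_ (Finset.single_le_sum
      (f := fun i => Real.exp (hA.eigenvalues i) + Real.exp (-hA.eigenvalues i))
      (fun j _ => by positivity) (Finset.mem_univ i))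
    rcases abs_cases (hA.eigenvalues i) with h | h <;> rw [h.1] <;>
      linarith [Real.exp_pos (hA.eigenvalues i), Real.exp_pos (-hA.eigenvalues i)]
  obtain ⟨i₀⟩ := ‹Nonempty d›
  have hpos := (Real.exp_pos _).trans_le (key i₀)
  rw [← Real.le_log_iff_exp_le hpos]
  have hlog : ∀ i, |hA.eigenvalues i| ≤ Real.log ((exp A).trace.re + (exp (-A)).trace.re) :=
    fun i => (Real.le_log_iff_exp_le hpos).mpr (key i)
  have h := norm_cfc_le (f := (id : ℝ → ℝ)) (a := A) ((abs_nonneg _).trans (hlog i₀))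
    (by
      intro x hx
      rw [hA.spectrum_real_eq_range_eigenvalues] at hx
      obtain ⟨i, rfl⟩ := hx
      exact hlog i)
  rwa [cfc_id ℝ A] at h

/-- `A ⊗ B = (A ⊗ 1) (1 ⊗ B)`, and star homomorphisms of C⋆-algebras are contractions. -/
lemma norm_kronecker_le {e : Type*} [Fintype e] [DecidableEq e] (A : Matrix d d ℂ)
    (B : Matrix e e ℂ) : ‖A ⊗ₖ B‖ ≤ ‖A‖ * ‖B‖ := by
  let φ : Matrix d d ℂ →⋆ₐ[ℂ] Matrix (d × e) (d × e) ℂ :=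
    { toFun := fun A => A ⊗ₖ (1 : Matrix e e ℂ)
      map_one' := by simp
      map_mul' := fun A B => by rw [← Matrix.mul_kronecker_mul, one_mul]
      map_zero' := by simp
      map_add' := fun A B => Matrix.add_kronecker _ _ _
      commutes' := fun r => by
        simp [Algebra.algebraMap_eq_smul_one, Matrix.smul_kronecker]
      map_star' := fun A => by simp [Matrix.star_eq_conjTranspose, Matrix.conjTranspose_kronecker] }
  let ψ : Matrix e e ℂ →⋆ₐ[ℂ] Matrix (d × e) (d × e) ℂ :=
    { toFun := fun A => (1 : Matrix d d ℂ) ⊗ₖ A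
      map_one' := by simp
      map_mul' := fun A B => by rw [← Matrix.mul_kronecker_mul, one_mul]
      map_zero' := by simp
      map_add' := fun A B => Matrix.kronecker_add _ _ _
      commutes' := fun r => by
        simp [Algebra.algebraMap_eq_smul_one, Matrix.kronecker_smul]
      map_star' := fun A => by simp [Matrix.star_eq_conjTranspose, Matrix.conjTranspose_kronecker] }
  have h : A ⊗ₖ B = φ A * ψ B := by
    change _ = (A ⊗ₖ 1) * (1 ⊗ₖ B)
    rw [← Matrix.mul_kronecker_mul, one_mul, mul_one]
  rw [h]
  refine (norm_mul_le _ _).trans ?_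
  gcongr
  · exact NonUnitalStarAlgHom.norm_apply_le φ A
  · exact NonUnitalStarAlgHom.norm_apply_le ψ B

end Spectral

/-! ### The matrix Bernstein inequality -/

section Bernstein

variable {d : Type*} [Fintype d] [DecidableEq d]

open NormedSpace in
lemma continuous_matrix_exp : Continuous (exp : Matrix d d ℂ → Matrix d d ℂ) := by
  let _ : NormedAlgebra ℚ (Matrix d d ℂ) := NormedAlgebra.restrictScalars ℚ ℝ _
  exact exp_continuous

/-- The real trace as a continuous linear functional. -/
noncomputable def reTraceCLM : Matrix d d ℂ →L[ℝ] ℝ :=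
  LinearMap.toContinuousLinearMap (Complex.reLm ∘ₗ (Matrix.traceLinearMap d ℝ ℂ))

variable {Ω : Type*} [MeasurableSpace Ω] {P : Measure Ω}

lemma integral_re_trace {f : Ω → Matrix d d ℂ} (hf : Integrable f P) :
    ∫ ω, (f ω).trace.re ∂P = (∫ ω, f ω ∂P).trace.re :=
  reTraceCLM.integral_comp_comm hf

lemma integral_isHermitian {f : Ω → Matrix d d ℂ} (h : ∀ᵐ ω ∂P, (f ω).IsHermitian) :
    (∫ ω, f ω ∂P).IsHermitian := by
  let L : Matrix d d ℂ ≃L[ℝ] Matrix d d ℂ :=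
    (Matrix.conjTransposeLinearEquiv d d ℝ ℂ).toContinuousLinearEquiv
  have h1 := L.integral_comp_comm f (μ := P)
  have h2 : ∫ ω, L (f ω) ∂P = ∫ ω, f ω ∂P := integral_congr_ae (h.mono fun ω hω => hω)
  exact h1.symm.trans h2

lemma integral_re_trace_mul_left {f : Ω → Matrix d d ℂ} (hf : Integrable f P)
    (A : Matrix d d ℂ) : ∫ ω, (A * f ω).trace.re ∂P = (A * ∫ ω, f ω ∂P).trace.re := by
  rw [integral_re_trace (hf.const_mul A)]
  congr 2
  exact ((ContinuousLinearMap.mul ℝ (Matrix d d ℂ)) A).integral_comp_comm hf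

lemma integral_re_trace_mul_right {f : Ω → Matrix d d ℂ} (hf : Integrable f P)
    (A : Matrix d d ℂ) : ∫ ω, (f ω * A).trace.re ∂P = ((∫ ω, f ω ∂P) * A).trace.re := by
  simp_rw [Matrix.trace_mul_comm _ A]
  exact integral_re_trace_mul_left hf A

lemma integral_re_trace_mul_of_indepFun [MeasurableSpace (Matrix d d ℂ)] [BorelSpace (Matrix d d ℂ)]
    {f g : Ω → Matrix d d ℂ} (h : IndepFun f g P) (hf : Integrable f P) (hg : Integrable g P) :
    ∫ ω, (f ω * g ω).trace.re ∂P = ((∫ ω, f ω ∂P) * ∫ ω, g ω ∂P).trace.re := by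
  let B : Matrix d d ℂ →L[ℝ] Matrix d d ℂ →L[ℝ] ℝ :=
    (ContinuousLinearMap.compL ℝ (Matrix d d ℂ) (Matrix d d ℂ) ℝ reTraceCLM).comp
      (ContinuousLinearMap.mul ℝ (Matrix d d ℂ))
  exact h.integral_bilin hf hg B

variable [IsProbabilityMeasure P]

open NormedSpace in
lemma integrable_exp {W : Ω → Matrix d d ℂ} {K : ℝ} (hW : AEStronglyMeasurable W P)
    (hK : ∀ᵐ ω ∂P, ‖W ω‖ ≤ K) : Integrable (fun ω => exp (W ω)) P := by
  refine .of_bound (continuous_matrix_exp.comp_aestronglyMeasurable hW) (Real.exp K) ?_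
  filter_upwards [hK] with ω h
  exact (l2_opNorm_exp_le _).trans (Real.exp_le_exp.mpr h)

variable [MeasurableSpace (Matrix d d ℂ)] [BorelSpace (Matrix d d ℂ)]

open NormedSpace in
/-- One step of the Ahlswede–Winter argument: an independent centred summand `Z` with `‖Z‖ ≤ 1`
multiplies the trace exponential moment by at most `1 + ‖𝔼 Z²‖`. -/
lemma integral_trace_exp_add_le {W Z : Ω → Matrix d d ℂ} {K s : ℝ} (hind : IndepFun W Z P)
    (hWm : AEStronglyMeasurable W P) (hZm : AEStronglyMeasurable Z P)
    (hW : ∀ᵐ ω ∂P, (W ω).IsHermitian ∧ ‖W ω‖ ≤ K)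
    (hZ : ∀ᵐ ω ∂P, (Z ω).IsHermitian ∧ ‖Z ω‖ ≤ 1)
    (hZ0 : ∫ ω, Z ω ∂P = 0) (hZs : ‖∫ ω, Z ω ^ 2 ∂P‖ ≤ s) :
    ∫ ω, (exp (W ω + Z ω)).trace.re ∂P ≤ (1 + s) * ∫ ω, (exp (W ω)).trace.re ∂P := by
  have hZi : Integrable Z P := .of_bound hZm 1 (hZ.mono fun ω h => h.2)
  have hZ2m : AEStronglyMeasurable (fun ω => Z ω ^ 2) P :=
    (continuous_pow 2).comp_aestronglyMeasurable hZm
  have hZ2 : Integrable (fun ω => Z ω ^ 2) P := by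
    refine .of_bound hZ2m 1 ?_
    filter_upwards [hZ] with ω h
    exact (norm_pow_le' _ two_pos).trans (pow_le_one₀ (norm_nonneg _) h.2)
  have hEi : Integrable (fun ω => exp (W ω)) P := integrable_exp hWm (hW.mono fun ω h => h.2)
  have h1Z : Integrable (fun ω => 1 + Z ω) P := (integrable_const _).add hZi
  have hpolyi : Integrable (fun ω => 1 + Z ω + Z ω ^ 2) P := h1Z.add hZ2
  have hind' : IndepFun (fun ω => exp (W ω)) (fun ω => 1 + Z ω + Z ω ^ 2) P :=
    hind.comp (φ := exp) (ψ := fun A : Matrix d d ℂ => 1 + A + A ^ 2)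
      continuous_matrix_exp.measurable (by fun_prop : Continuous _).measurable
  have hpoly : ∫ ω, (1 + Z ω + Z ω ^ 2) ∂P = 1 + ∫ ω, Z ω ^ 2 ∂P := by
    rw [integral_add h1Z hZ2, integral_add (integrable_const _) hZi, hZ0]
    simp
  have hM : (∫ ω, Z ω ^ 2 ∂P).IsHermitian :=
    integral_isHermitian (hZ.mono fun ω h => h.1.pow 2)
  have hprodi : Integrable (fun ω => exp (W ω) * (1 + Z ω + Z ω ^ 2)) P := by
    refine .of_bound (hEi.1.mul hpolyi.1) (Real.exp K * (‖(1 : Matrix d d ℂ)‖ + 1 + 1)) ?_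
    filter_upwards [hW, hZ] with ω h1 h2
    refine (norm_mul_le _ _).trans ?_
    gcongr
    · exact (l2_opNorm_exp_le _).trans (Real.exp_le_exp.mpr h1.2)
    · refine (norm_add_le _ _).trans
        (add_le_add ((norm_add_le _ _).trans (by gcongr; exact h2.2)) ?_)
      exact (norm_pow_le' _ two_pos).trans (pow_le_one₀ (norm_nonneg _) h2.2)
  have hsumi : Integrable (fun ω => exp (W ω + Z ω)) P := by
    refine integrable_exp (K := K + 1) (hWm.add hZm) ?_
    filter_upwards [hW, hZ] with ω h1 h2
    exact (norm_add_le _ _).trans (add_le_add h1.2 h2.2)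
  calc ∫ ω, (exp (W ω + Z ω)).trace.re ∂P
      ≤ ∫ ω, (exp (W ω) * (1 + Z ω + Z ω ^ 2)).trace.re ∂P := by
        refine integral_mono_ae (reTraceCLM.integrable_comp hsumi)
          (reTraceCLM.integrable_comp hprodi) ?_
        filter_upwards [hW, hZ] with ω h1 h2
        exact (golden_thompson h1.1 h2.1).trans
          (re_trace_mul_mono (posSemidef_exp h1.1) (posSemidef_sub_exp h2.1 h2.2))
    _ = ∫ ω, (exp (W ω) * (1 + ∫ ω, Z ω ^ 2 ∂P)).trace.re ∂P := by
        rw [integral_re_trace_mul_of_indepFun hind' hEi hpolyi, hpoly,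
          integral_re_trace_mul_right hEi]
    _ ≤ ∫ ω, (1 + s) * (exp (W ω)).trace.re ∂P := by
        refine integral_mono_ae (reTraceCLM.integrable_comp (hEi.mul_const _))
          ((reTraceCLM.integrable_comp hEi).const_mul _) ?_
        filter_upwards [hW] with ω h1
        have hp := posSemidef_exp h1.1
        have h0 : 0 ≤ (exp (W ω)).trace.re := (Complex.le_def.mp hp.trace_nonneg).1
        have h2 := re_trace_mul_le_norm hp hM
        simp only [mul_add, mul_one, Matrix.trace_add, Complex.add_re]
        nlinarith [mul_le_mul_of_nonneg_left hZs h0]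
    _ = _ := integral_const_mul _ _

variable {ι : Type*}

open NormedSpace in
/-- The trace exponential moment bound for a sum, by induction on the number of summands. -/
lemma integral_trace_exp_sum_le {Z : ι → Ω → Matrix d d ℂ} {s : ℝ} (hind : iIndepFun Z P)
    (hm : ∀ j, AEMeasurable (Z j) P)
    (hZ : ∀ j, ∀ᵐ ω ∂P, (Z j ω).IsHermitian ∧ ‖Z j ω‖ ≤ 1)
    (hZ0 : ∀ j, ∫ ω, Z j ω ∂P = 0) (hZs : ∀ j, ‖∫ ω, Z j ω ^ 2 ∂P‖ ≤ s) (J : Finset ι) :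
    ∫ ω, (exp (∑ j ∈ J, Z j ω)).trace.re ∂P ≤ Fintype.card d * Real.exp (J.card * s) := by
  classical
  induction J using Finset.induction_on with
  | empty => simp
  | insert j J hj ih =>
    have hbd : ∀ᵐ ω ∂P, (∑ i ∈ J, Z i ω).IsHermitian ∧ ‖∑ i ∈ J, Z i ω‖ ≤ J.card := by
      have h := (Filter.eventually_all_finset J).mpr fun i _ => hZ i
      filter_upwards [h] with ω hω
      refine ⟨isSelfAdjoint_sum _ fun i hi => (hω i hi).1, ?_⟩
      exact (norm_sum_le_of_le J fun i hi => (hω i hi).2).trans (by simp)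
    have hmJ : AEMeasurable (fun ω => ∑ i ∈ J, Z i ω) P :=
      Finset.aemeasurable_fun_sum J fun i _ => hm i
    have hindJ : IndepFun (fun ω => ∑ i ∈ J, Z i ω) (Z j) P := by
      have := hind.indepFun_finsetSum_of_notMem₀ hm hj
      rwa [Finset.sum_fn] at this
    have hs0 : 0 ≤ s := (norm_nonneg _).trans (hZs j)
    have h := integral_trace_exp_add_le hindJ hmJ.aestronglyMeasurable
      (hm j).aestronglyMeasurable hbd (hZ j) (hZ0 j) (hZs j)
    simp only [Finset.sum_insert hj, add_comm (Z j _)]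
    refine h.trans ((mul_le_mul_of_nonneg_left ih (by positivity)).trans ?_)
    rw [Finset.card_insert_of_notMem hj, Nat.cast_add, Nat.cast_one, add_mul (J.card : ℝ),
      one_mul, Real.exp_add]
    have h1 : 1 + s ≤ Real.exp s := by linarith [Real.add_one_le_exp s]
    calc _ ≤ Real.exp s * (Fintype.card d * Real.exp (J.card * s)) := by gcongr
      _ = _ := by ring

/-- The choice of the exponent in the Chernoff bound. -/
lemma exists_chernoff_parameter {σ b T N : ℝ} (hσ : 0 ≤ σ) (hb : 0 < b) (hT : 0 < T)
    (hN : 0 < N) : ∃ l : ℝ, 0 < l ∧ l * b ≤ 1 ∧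
      N * (l ^ 2 * σ ^ 2) + T ≤ l * N * (2 * σ * √(T / N) + b * (T / N)) := by
  set r := √(T / N) with hr
  have hr0 : 0 < r := Real.sqrt_pos.mpr (by positivity)
  have hT' : T = N * r ^ 2 := by rw [hr, Real.sq_sqrt (by positivity)]; field_simp
  have hTN : T / N = r ^ 2 := by rw [hr, Real.sq_sqrt (by positivity)]
  rw [hTN, hT']
  by_cases h : b * r ≤ σ
  · have hσ' : 0 < σ := (by positivity : 0 < b * r).trans_le h
    refine ⟨r / σ, by positivity, ?_, ?_⟩
    · rw [div_mul_eq_mul_div, div_le_one hσ']; linarith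
    · have e : r / σ * N * (2 * σ * r + b * r ^ 2)
          = N * r ^ 2 + N * r ^ 2 + r / σ * N * (b * r ^ 2) := by field_simp; ring
      have e2 : N * ((r / σ) ^ 2 * σ ^ 2) = N * r ^ 2 := by field_simp
      rw [e, e2]
      have : 0 ≤ r / σ * N * (b * r ^ 2) := by positivity
      linarith
  · push Not at h
    refine ⟨1 / b, by positivity, by field_simp; rfl, ?_⟩
    have e : 1 / b * N * (2 * σ * r + b * r ^ 2) = N * ((2 * σ * r / b) + r ^ 2) := by
      field_simp
    rw [e, mul_add]
    gcongr
    rw [div_pow, one_pow, div_mul_eq_mul_div, one_mul, div_le_div_iff₀ (by positivity) hb]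
    have : σ ^ 2 ≤ 2 * σ * r * b := by nlinarith
    nlinarith

open NormedSpace in
/-- **Matrix Bernstein inequality** (Ahlswede–Winter form) for averages of independent centred
Hermitian random matrices. -/
theorem matrix_bernstein [Nonempty d] {n : ℕ} (hn : 0 < n) {Z : Fin n → Ω → Matrix d d ℂ}
    {σ b T : ℝ} (hσ : 0 ≤ σ) (hb : 0 < b) (hT : 0 < T) (hind : iIndepFun Z P)
    (hm : ∀ j, AEMeasurable (Z j) P)
    (hZ : ∀ j, ∀ᵐ ω ∂P, (Z j ω).IsHermitian ∧ ‖Z j ω‖ ≤ b)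
    (hZ0 : ∀ j, ∫ ω, Z j ω ∂P = 0) (hZs : ∀ j, ‖∫ ω, Z j ω ^ 2 ∂P‖ ≤ σ ^ 2) :
    P.real {ω | 2 * σ * √(T / n) + b * (T / n) < ‖(n : ℝ)⁻¹ • ∑ j, Z j ω‖}
      ≤ 2 * Fintype.card d * Real.exp (-T) := by
  have hn' : (0 : ℝ) < n := by exact_mod_cast hn
  obtain ⟨l, hl0, hlb, hl⟩ := exists_chernoff_parameter hσ hb hT hn'
  set q := 2 * σ * √(T / n) + b * (T / n) with hq
  -- the moment bound applies to `r • Z j` for `r = l` and for `r = -l`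
  have hmgf : ∀ r : ℝ, |r| = l → ∫ ω, (exp (r • ∑ j, Z j ω)).trace.re ∂P
      ≤ Fintype.card d * Real.exp (n * (l ^ 2 * σ ^ 2)) := by
    intro r hr
    have h := integral_trace_exp_sum_le (P := P) (Z := fun j ω => r • Z j ω) (s := l ^ 2 * σ ^ 2)
      (hind.comp (fun _ A => r • A) fun _ => measurable_const_smul r)
      (fun j => (hm j).const_smul r)
      (fun j => (hZ j).mono fun ω h => ⟨h.1.smul (IsSelfAdjoint.all r), by
        rw [norm_smul, Real.norm_eq_abs, hr]
        exact (mul_le_mul_of_nonneg_left h.2 hl0.le).trans hlb⟩)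
      (fun j => by rw [integral_smul, hZ0, smul_zero])
      (fun j => by
        simp_rw [smul_pow]
        rw [integral_smul, norm_smul, norm_pow, Real.norm_eq_abs, hr]
        gcongr
        exact hZs j) Finset.univ
    simpa [Finset.smul_sum] using h
  have hH : ∀ᵐ ω ∂P, (∑ j, Z j ω).IsHermitian ∧ ‖∑ j, Z j ω‖ ≤ n * b := by
    filter_upwards [Filter.eventually_all.mpr hZ] with ω h
    refine ⟨isSelfAdjoint_sum _ fun j _ => (h j).1, ?_⟩
    exact (norm_sum_le_of_le _ fun j _ => (h j).2).trans (by simp)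
  have hSm : AEStronglyMeasurable (fun ω => ∑ j, Z j ω) P :=
    (Finset.aemeasurable_fun_sum _ fun j _ => hm j).aestronglyMeasurable
  have hint : ∀ r : ℝ, Integrable (fun ω => (exp (r • ∑ j, Z j ω)).trace.re) P := fun r => by
    refine reTraceCLM.integrable_comp (integrable_exp (K := |r| * (n * b)) (hSm.const_smul r) ?_)
    filter_upwards [hH] with ω h
    rw [Pi.smul_apply, norm_smul, Real.norm_eq_abs]
    gcongr
    exact h.2
  set g : Ω → ℝ := fun ω => (exp (l • ∑ j, Z j ω)).trace.re + (exp ((-l) • ∑ j, Z j ω)).trace.re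
  have hg0 : 0 ≤ᵐ[P] g := by
    filter_upwards [hH] with ω h
    have h1 : ∀ r : ℝ, 0 ≤ (exp (r • ∑ j, Z j ω)).trace.re := fun r =>
      (Complex.le_def.mp (posSemidef_exp (h.1.smul (IsSelfAdjoint.all r))).trace_nonneg).1
    exact add_nonneg (h1 _) (h1 _)
  have hmarkov := mul_meas_ge_le_integral_of_nonneg hg0 ((hint l).add (hint (-l)))
    (Real.exp (l * (n * q)))
  have hle : P.real {ω | q < ‖(n : ℝ)⁻¹ • ∑ j, Z j ω‖}
      ≤ P.real {ω | Real.exp (l * (n * q)) ≤ g ω} := by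
    refine ENNReal.toReal_mono (measure_ne_top _ _) (measure_mono_ae ?_)
    filter_upwards [hH] with ω h hω
    change q < ‖(n : ℝ)⁻¹ • ∑ j, Z j ω‖ at hω
    have h2 := exp_norm_le_trace_exp (h.1.smul (IsSelfAdjoint.all l))
    rw [← neg_smul] at h2
    refine le_trans (Real.exp_le_exp.mpr ?_) h2
    rw [norm_smul, Real.norm_of_nonneg hl0.le]
    gcongr
    rw [norm_smul, norm_inv, Real.norm_natCast, lt_inv_mul_iff₀ hn'] at hω
    exact hω.le
  have hEg : ∫ ω, g ω ∂P ≤ 2 * Fintype.card d * Real.exp (n * (l ^ 2 * σ ^ 2)) := by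
    rw [integral_add (hint l) (hint (-l))]
    have h1 := hmgf l (abs_of_pos hl0)
    have h2 := hmgf (-l) (by rw [abs_neg, abs_of_pos hl0])
    linarith
  refine hle.trans ?_
  have hexp : Real.exp (n * (l ^ 2 * σ ^ 2)) ≤ Real.exp (l * (n * q)) * Real.exp (-T) := by
    rw [← Real.exp_add]
    refine Real.exp_le_exp.mpr ?_
    linarith
  refine le_of_mul_le_mul_left (hmarkov.trans (hEg.trans ?_)) (Real.exp_pos (l * (n * q)))
  calc _ ≤ 2 * Fintype.card d * (Real.exp (l * (n * q)) * Real.exp (-T)) := by gcongr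
    _ = _ := by ring

end Bernstein

/-! ### The von Neumann entropy of a state -/

section Entropy

variable {m : ℕ}

lemma continuousOn_spectrum {S : Matrix (Fin m) (Fin m) ℂ} (f : ℝ → ℝ) :
    ContinuousOn f (spectrum ℝ S) :=
  (Matrix.finite_real_spectrum (A := S)).continuousOn f

lemma trace_mul_matLog {S : Matrix (Fin m) (Fin m) ℂ} (hS : S.IsHermitian) :
    S * matLog S = cfc (fun x => x * Real.log x) S := by
  rw [cfc_mul (fun x : ℝ => x) Real.log S (continuousOn_spectrum _) (continuousOn_spectrum _),
    cfc_id' ℝ S hS.isSelfAdjoint, matLog]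

lemma sum_eigenvalues_eq_one {S : Matrix (Fin m) (Fin m) ℂ} (hS : S ∈ states m) :
    ∑ i, hS.1.1.eigenvalues i = 1 := by
  rw [sum_eigenvalues, hS.2, Complex.one_re]

lemma pos_of_mem_states {S : Matrix (Fin m) (Fin m) ℂ} (hS : S ∈ states m) : 0 < m := by
  rcases Nat.eq_zero_or_pos m with rfl | h
  · have := sum_eigenvalues_eq_one hS
    simp at this
  · exact h

lemma entropy_eq_sum {S : Matrix (Fin m) (Fin m) ℂ} (hS : S ∈ states m) :
    (S * matLog S).trace.re = ∑ i, hS.1.1.eigenvalues i * Real.log (hS.1.1.eigenvalues i) := by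
  rw [trace_mul_matLog hS.1.1, trace_cfc hS.1.1, Complex.ofReal_re]

lemma re_trace_mul_matLog_nonpos {S : Matrix (Fin m) (Fin m) ℂ} (hS : S ∈ states m) :
    (S * matLog S).trace.re ≤ 0 := by
  rw [entropy_eq_sum hS]
  refine Finset.sum_nonpos fun i _ => ?_
  have h0 := hS.1.eigenvalues_nonneg i
  refine mul_nonpos_of_nonneg_of_nonpos h0 (Real.log_nonpos h0 ?_)
  rw [← sum_eigenvalues_eq_one hS]
  exact Finset.single_le_sum (fun j _ => hS.1.eigenvalues_nonneg j) (Finset.mem_univ i)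

/-- The von Neumann entropy is at most `log m`. -/
lemma neg_log_le_re_trace_mul_matLog {S : Matrix (Fin m) (Fin m) ℂ} (hS : S ∈ states m) :
    -Real.log m ≤ (S * matLog S).trace.re := by
  have hm : (0 : ℝ) < m := by exact_mod_cast pos_of_mem_states hS
  -- tangent line of `x log x` at `1 / m`
  have key : ∀ x : ℝ, 0 ≤ x → x - (m : ℝ)⁻¹ - x * Real.log m ≤ x * Real.log x := by
    intro x hx
    rcases hx.eq_or_lt with rfl | hx
    · simp
    · have h := Real.log_le_sub_one_of_pos (x := 1 / (m * x)) (by positivity)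
      rw [one_div, Real.log_inv, Real.log_mul hm.ne' hx.ne'] at h
      have h2 := mul_le_mul_of_nonneg_left h hx.le
      have h3 : x * ((m * x)⁻¹ - 1) = (m : ℝ)⁻¹ - x := by field_simp
      linarith
  rw [entropy_eq_sum hS]
  refine le_trans ?_ (Finset.sum_le_sum fun i _ => key _ (hS.1.eigenvalues_nonneg i))
  rw [Finset.sum_sub_distrib, Finset.sum_sub_distrib, ← Finset.sum_mul, sum_eigenvalues_eq_one hS]
  simp [hm.ne']

/-- The least eigenvalue of a state is at most `1 / m`. -/
lemma log_le_norm_matLog {S : Matrix (Fin m) (Fin m) ℂ} (hS : S ∈ states m) (hpd : S.PosDef) :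
    Real.log m ≤ ‖matLog S‖ := by
  have hm : (0 : ℝ) < m := by exact_mod_cast pos_of_mem_states hS
  obtain ⟨i, hi⟩ : ∃ i, hS.1.1.eigenvalues i ≤ (m : ℝ)⁻¹ := by
    by_contra! h
    have : Nonempty (Fin m) := ⟨⟨0, pos_of_mem_states hS⟩⟩
    have h1 := Finset.sum_lt_sum_of_nonempty (s := Finset.univ) Finset.univ_nonempty
      fun i _ => h i
    rw [sum_eigenvalues_eq_one hS] at h1
    simp [hm.ne'] at h1
  have hpos : 0 < hS.1.1.eigenvalues i := hpd.eigenvalues_pos i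
  have h := norm_apply_le_norm_cfc Real.log S (hS.1.1.eigenvalues_mem_spectrum_real i)
    (continuousOn_spectrum _) hS.1.1.isSelfAdjoint
  refine le_trans ?_ h
  rw [Real.norm_eq_abs]
  have h2 := Real.log_le_log hpos hi
  rw [Real.log_inv] at h2
  linarith [neg_le_abs (Real.log (hS.1.1.eigenvalues i))]

/-- Both `‖log S‖` and `log Γ` are at least `log m`, so the penalty term dominates `ε log m`. -/
lemma mul_log_le_penaltyTerm (Q : Measure (Matrix (Fin m) (Fin m) ℂ)) {ε : ℝ} (hε : 0 ≤ ε)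
    {S : Matrix (Fin m) (Fin m) ℂ} (hS : S ∈ states m) :
    ε * Real.log m ≤ penaltyTerm Q ε S := by
  have hm : (0 : ℝ) < m := by exact_mod_cast pos_of_mem_states hS
  have hG : Real.log m ≤ Real.log (Gam Q ε) := Real.log_le_log hm (le_max_right _ _)
  rw [penaltyTerm]
  refine mul_le_mul_of_nonneg_left ?_ hε
  split_ifs with h
  · exact le_min (log_le_norm_matLog hS h) hG
  · exact hG

lemma re_trace_mul_matLog_convex {R S : Matrix (Fin m) (Fin m) ℂ} (hR : R ∈ states m)
    (hS : S ∈ states m) {a b : ℝ} (ha : 0 ≤ a) (hb : 0 ≤ b) (hab : a + b = 1) :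
    ((a • R + b • S) * matLog (a • R + b • S)).trace.re
      ≤ a * (R * matLog R).trace.re + b * (S * matLog S).trace.re := by
  have hC : (a • R + b • S).IsHermitian :=
    (hR.1.1.smul (IsSelfAdjoint.all a)).add (hS.1.1.smul (IsSelfAdjoint.all b))
  rw [trace_mul_matLog hC, trace_mul_matLog hR.1.1, trace_mul_matLog hS.1.1]
  exact trace_cfc_convex Real.convexOn_mul_log hR.1.1 hS.1.1 hR.1.eigenvalues_nonneg
    hS.1.eigenvalues_nonneg ha hb hab

lemma states_convex_comb {R S : Matrix (Fin m) (Fin m) ℂ} (hR : R ∈ states m)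
    (hS : S ∈ states m) {a b : ℝ} (ha : 0 ≤ a) (hb : 0 ≤ b) (hab : a + b = 1) :
    a • R + b • S ∈ states m := by
  refine ⟨(hR.1.smul ha).add (hS.1.smul hb), ?_⟩
  rw [Matrix.trace_add, Matrix.trace_smul, Matrix.trace_smul, hR.2, hS.2, ← add_smul, hab, one_smul]

end Entropy

/-! ### The deterministic oracle inequality -/

section Deterministic

variable {m n : ℕ}

/-- The squared empirical norm `n⁻¹ ∑ⱼ (tr (A xⱼ))²`. -/
noncomputable def empSq (x : Fin n → Matrix (Fin m) (Fin m) ℂ) (A : Matrix (Fin m) (Fin m) ℂ) :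
    ℝ :=
  (n : ℝ)⁻¹ * ∑ j, (A * x j).trace.re ^ 2

lemma empSq_nonneg (x : Fin n → Matrix (Fin m) (Fin m) ℂ) (A : Matrix (Fin m) (Fin m) ℂ) :
    0 ≤ empSq x A := by unfold empSq; positivity

/-- The first-order optimality condition for the minimizer of a sum of a quadratic and a convex
function. -/
lemma IsEstimate.empSq_add_le {x : Fin n → Matrix (Fin m) (Fin m) ℂ} {y : Fin n → ℝ} {ε : ℝ}
    (hε : 0 ≤ ε) {R : Matrix (Fin m) (Fin m) ℂ} (hR : IsEstimate x y ε R)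
    {S : Matrix (Fin m) (Fin m) ℂ} (hS : S ∈ states m) :
    empSq x (R - S) + empiricalObjective x y ε R ≤ empiricalObjective x y ε S := by
  -- compare `R` with the states on the segment from `R` to `S`, and let them tend to `R`
  have key : ∀ b : ℝ, 0 < b → b < 1 →
      (1 - b) * empSq x (R - S) ≤ empiricalObjective x y ε S - empiricalObjective x y ε R := by
    intro b hb0 hb1
    have hmin := hR.2 (states_convex_comb hR.1 hS (sub_nonneg.mpr hb1.le) hb0.le (by ring))
    have hent := mul_le_mul_of_nonneg_left
      (re_trace_mul_matLog_convex hR.1 hS (sub_nonneg.mpr hb1.le) hb0.le (by ring)) hε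
    change empiricalObjective x y ε R ≤ empiricalObjective x y ε _ at hmin
    have hquad : ∑ j, (y j - (((1 - b) • R + b • S) * x j).trace.re) ^ 2
        = (1 - b) * ∑ j, (y j - (R * x j).trace.re) ^ 2
          + b * ∑ j, (y j - (S * x j).trace.re) ^ 2
          - b * (1 - b) * ∑ j, ((R - S) * x j).trace.re ^ 2 := by
      simp only [Finset.mul_sum, ← Finset.sum_add_distrib, ← Finset.sum_sub_distrib]
      refine Finset.sum_congr rfl fun j _ => ?_
      simp only [add_mul, sub_mul, Matrix.smul_mul, Matrix.trace_add, Matrix.trace_sub,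
        Matrix.trace_smul, Complex.add_re, Complex.sub_re, Complex.smul_re, smul_eq_mul]
      ring
    have h : b * ((1 - b) * empSq x (R - S))
        ≤ b * (empiricalObjective x y ε S - empiricalObjective x y ε R) := by
      simp only [empiricalObjective, empSq] at hmin ⊢
      rw [hquad] at hmin
      linear_combination hmin + hent
    exact le_of_mul_le_mul_left h hb0
  have h0 := empSq_nonneg x (R - S)
  have hD : 0 ≤ empiricalObjective x y ε S - empiricalObjective x y ε R := sub_nonneg.mpr (hR.2 hS)
  by_contra! hlt
  set q := empSq x (R - S)
  set D := empiricalObjective x y ε S - empiricalObjective x y ε R with hDdef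
  have hqD : D < q := by linarith
  have hq : 0 < q := hD.trans_lt hqD
  have h := key ((q - D) / (2 * q)) (by apply div_pos <;> linarith)
    (by rw [div_lt_one (by linarith)]; linarith)
  have e : (1 - (q - D) / (2 * q)) * q = (q + D) / 2 := by field_simp; ring
  linarith

/-- Optimality of the estimate, with the squares expanded around the true state `ρ`. -/
lemma IsEstimate.basic_inequality {x : Fin n → Matrix (Fin m) (Fin m) ℂ} {ξ : Fin n → ℝ} {ε : ℝ}
    (hε : 0 ≤ ε) {ρ R S : Matrix (Fin m) (Fin m) ℂ}
    (hR : IsEstimate x (fun j => (ρ * x j).trace.re + ξ j) ε R) (hS : S ∈ states m) :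
    empSq x (R - S) + empSq x (R - ρ)
      ≤ empSq x (S - ρ) + 2 * ((R - S) * (n : ℝ)⁻¹ • ∑ j, ξ j • x j).trace.re
        + ε * Real.log m := by
  have h := hR.empSq_add_le hε hS
  have h1 := mul_le_mul_of_nonneg_left (re_trace_mul_matLog_nonpos hS) hε
  have h2 := mul_le_mul_of_nonneg_left (neg_log_le_re_trace_mul_matLog hR.1) hε
  have hN : ((R - S) * (n : ℝ)⁻¹ • ∑ j, ξ j • x j).trace.re
      = (n : ℝ)⁻¹ * ∑ j, ξ j * ((R - S) * x j).trace.re := by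
    simp only [Matrix.mul_smul, Matrix.mul_sum, Matrix.trace_smul, Matrix.trace_sum,
      Complex.smul_re, Complex.re_sum, smul_eq_mul]
  have hq : ∀ A : Matrix (Fin m) (Fin m) ℂ,
      ∑ j, ((ρ * x j).trace.re + ξ j - (A * x j).trace.re) ^ 2
        = ∑ j, ((A - ρ) * x j).trace.re ^ 2 - 2 * ∑ j, ξ j * ((A - ρ) * x j).trace.re
          + ∑ j, ξ j ^ 2 := by
    intro A
    simp only [Finset.mul_sum, ← Finset.sum_add_distrib, ← Finset.sum_sub_distrib]
    refine Finset.sum_congr rfl fun j _ => ?_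
    simp only [sub_mul, Matrix.trace_sub, Complex.sub_re]
    ring
  have hlin : ∑ j, ξ j * ((R - S) * x j).trace.re
      = ∑ j, ξ j * ((R - ρ) * x j).trace.re - ∑ j, ξ j * ((S - ρ) * x j).trace.re := by
    simp only [← Finset.sum_sub_distrib]
    refine Finset.sum_congr rfl fun j _ => ?_
    simp only [sub_mul, Matrix.trace_sub, Complex.sub_re]
    ring
  simp only [empiricalObjective] at h
  rw [hq R, hq S] at h
  rw [hN, hlin]
  simp only [empSq] at h ⊢
  linarith

lemma trace_mul_im_eq_zero {d : Type*} [Fintype d] {A B : Matrix d d ℂ} (hA : A.IsHermitian)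
    (hB : B.IsHermitian) : (A * B).trace.im = 0 := by
  have h : star (A * B).trace = (A * B).trace := by
    rw [← Matrix.trace_conjTranspose, Matrix.conjTranspose_mul, hA.eq, hB.eq, Matrix.trace_mul_comm]
  exact Complex.conj_eq_iff_im.mp h

lemma sq_re_trace_mul {A B : Matrix (Fin m) (Fin m) ℂ} (hA : A.IsHermitian) (hB : B.IsHermitian) :
    (A * B).trace.re ^ 2 = ((A ⊗ₖ A) * (B ⊗ₖ B)).trace.re := by
  rw [← Matrix.mul_kronecker_mul, Matrix.trace_kronecker, Complex.mul_re,
    trace_mul_im_eq_zero hA hB]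
  ring

/-- Trace duality for the difference of two states, whose trace norm is at most two. -/
lemma re_trace_sub_mul_le {d : Type*} [Fintype d] [DecidableEq d] {R S A : Matrix d d ℂ}
    (hR : R.PosSemidef) (hR1 : R.trace = 1) (hS : S.PosSemidef) (hS1 : S.trace = 1)
    (hA : A.IsHermitian) : |((R - S) * A).trace.re| ≤ 2 * ‖A‖ := by
  have h1 := abs_re_trace_mul_le_norm hR hA
  have h2 := abs_re_trace_mul_le_norm hS hA
  rw [hR1, Complex.one_re, one_mul] at h1
  rw [hS1, Complex.one_re, one_mul] at h2
  rw [sub_mul, Matrix.trace_sub, Complex.sub_re]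
  refine (abs_sub _ _).trans ?_
  linarith

lemma re_trace_kronecker_sub_mul_le {R S : Matrix (Fin m) (Fin m) ℂ} (hR : R ∈ states m)
    (hS : S ∈ states m) {A : Matrix (Fin m × Fin m) (Fin m × Fin m) ℂ} (hA : A.IsHermitian) :
    |(((R - S) ⊗ₖ (R - S)) * A).trace.re| ≤ 4 * ‖A‖ := by
  have hk : ∀ {B C : Matrix (Fin m) (Fin m) ℂ}, B ∈ states m → C ∈ states m →
      (B ⊗ₖ C).PosSemidef ∧ (B ⊗ₖ C).trace = 1 := fun hB hC =>
    ⟨hB.1.kronecker hC.1, by rw [Matrix.trace_kronecker, hB.2, hC.2, one_mul]⟩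
  have e : (R - S) ⊗ₖ (R - S) = (R ⊗ₖ R - R ⊗ₖ S) - (S ⊗ₖ R - S ⊗ₖ S) := by
    ext i j
    simp only [Matrix.kroneckerMap_apply, Matrix.sub_apply]
    ring
  have h1 := re_trace_sub_mul_le (hk hR hR).1 (hk hR hR).2 (hk hR hS).1 (hk hR hS).2 hA
  have h2 := re_trace_sub_mul_le (hk hS hR).1 (hk hS hR).2 (hk hS hS).1 (hk hS hS).2 hA
  rw [e, sub_mul, Matrix.trace_sub, Complex.sub_re]
  refine (abs_sub _ _).trans ?_
  linarith

lemma empSq_eq (x : Fin n → Matrix (Fin m) (Fin m) ℂ) (hx : ∀ j, (x j).IsHermitian)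
    {A : Matrix (Fin m) (Fin m) ℂ} (hA : A.IsHermitian) :
    empSq x A = ((A ⊗ₖ A) * (n : ℝ)⁻¹ • ∑ j, x j ⊗ₖ x j).trace.re := by
  simp only [empSq, Matrix.mul_smul, Matrix.mul_sum, Matrix.trace_smul, Matrix.trace_sum,
      Complex.smul_re, Complex.re_sum, smul_eq_mul, sq_re_trace_mul hA (hx _)]

lemma continuous_kronecker_self :
    Continuous fun x : Matrix (Fin m) (Fin m) ℂ => x ⊗ₖ x := by
  refine continuous_matrix fun i j => ?_
  change Continuous fun x : Matrix (Fin m) (Fin m) ℂ => x i.1 j.1 * x i.2 j.2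
  fun_prop

lemma isHermitian_kronecker_self {x : Matrix (Fin m) (Fin m) ℂ} (hx : x.IsHermitian) :
    (x ⊗ₖ x).IsHermitian := by
  rw [Matrix.IsHermitian, Matrix.conjTranspose_kronecker, hx.eq]

lemma norm_kronecker_self_le {x : Matrix (Fin m) (Fin m) ℂ} {U : ℝ} (hx : ‖x‖ ≤ U) :
    ‖x ⊗ₖ x‖ ≤ U ^ 2 :=
  (norm_kronecker_le x x).trans (by rw [← sq]; gcongr)

variable {Q : Measure (Matrix (Fin m) (Fin m) ℂ)} [IsProbabilityMeasure Q] {U : ℝ}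

lemma integrable_kronecker_self (hQ : ∀ᵐ x ∂Q, x.IsHermitian ∧ ‖x‖ ≤ U) :
    Integrable (fun x : Matrix (Fin m) (Fin m) ℂ => x ⊗ₖ x) Q :=
  .of_bound continuous_kronecker_self.aestronglyMeasurable (U ^ 2)
    (hQ.mono fun _ hx => norm_kronecker_self_le hx.2)

lemma sq_l2Norm_eq (hQ : ∀ᵐ x ∂Q, x.IsHermitian ∧ ‖x‖ ≤ U) {A : Matrix (Fin m) (Fin m) ℂ}
    (hA : A.IsHermitian) : l2Norm Q A ^ 2 = ((A ⊗ₖ A) * meanXX Q).trace.re := by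
  rw [l2Norm, Real.sq_sqrt (integral_nonneg fun _ => by positivity), meanXX,
    ← integral_re_trace_mul_left (integrable_kronecker_self hQ)]
  refine integral_congr_ae (hQ.mono fun x hx => ?_)
  dsimp only
  rw [← sq_re_trace_mul hA hx.1, hsInner, hx.1.eq,
    ← Complex.abs_re_eq_norm.mpr (trace_mul_im_eq_zero hA hx.1), sq_abs]

/-- The empirical and the population norm of a difference of states differ by at most four times
the fluctuation of `X ⊗ X`. -/
lemma abs_empSq_sub_sq_l2Norm_le (hn : 0 < n) (hQ : ∀ᵐ x ∂Q, x.IsHermitian ∧ ‖x‖ ≤ U)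
    {x : Fin n → Matrix (Fin m) (Fin m) ℂ} (hx : ∀ j, (x j).IsHermitian)
    {R S : Matrix (Fin m) (Fin m) ℂ} (hR : R ∈ states m) (hS : S ∈ states m) :
    |empSq x (R - S) - l2Norm Q (R - S) ^ 2|
      ≤ 4 * ‖(n : ℝ)⁻¹ • ∑ j, (x j ⊗ₖ x j - meanXX Q)‖ := by
  have hn' : (n : ℝ) ≠ 0 := by exact_mod_cast hn.ne'
  have hA : (R - S).IsHermitian := hR.1.1.sub hS.1.1
  have hM : (meanXX Q).IsHermitian :=
    integral_isHermitian (hQ.mono fun x hx => isHermitian_kronecker_self hx.1)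
  have e : (n : ℝ)⁻¹ • ∑ j, (x j ⊗ₖ x j - meanXX Q)
      = (n : ℝ)⁻¹ • ∑ j, x j ⊗ₖ x j - meanXX Q := by
    rw [Finset.sum_sub_distrib, smul_sub]
    congr 1
    rw [Finset.sum_const, Finset.card_univ, Fintype.card_fin, ← Nat.cast_smul_eq_nsmul ℝ, smul_smul,
      inv_mul_cancel₀ hn', one_smul]
  have hD : ((n : ℝ)⁻¹ • ∑ j, (x j ⊗ₖ x j - meanXX Q)).IsHermitian :=
    IsSelfAdjoint.smul (IsSelfAdjoint.all _)
      (isSelfAdjoint_sum _ fun j _ => (isHermitian_kronecker_self (hx j)).sub hM)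
  have h := re_trace_kronecker_sub_mul_le hR hS hD
  rwa [e, mul_sub, Matrix.trace_sub, Complex.sub_re, ← empSq_eq x hx hA, ← sq_l2Norm_eq hQ hA,
    ← e] at h

/-- The oracle inequality, with the two random fluctuations kept explicit. -/
lemma IsEstimate.oracle_inequality (hn : 0 < n) (hQ : ∀ᵐ x ∂Q, x.IsHermitian ∧ ‖x‖ ≤ U)
    {x : Fin n → Matrix (Fin m) (Fin m) ℂ} (hx : ∀ j, (x j).IsHermitian) {ξ : Fin n → ℝ} {ε : ℝ}
    (hε : 0 ≤ ε) {ρ R S : Matrix (Fin m) (Fin m) ℂ} (hρ : ρ ∈ states m) (hS : S ∈ states m)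
    (hR : IsEstimate x (fun j => (ρ * x j).trace.re + ξ j) ε R) :
    l2Norm Q (R - S) ^ 2 + l2Norm Q (R - ρ) ^ 2
      ≤ l2Norm Q (S - ρ) ^ 2 + 12 * ‖(n : ℝ)⁻¹ • ∑ j, (x j ⊗ₖ x j - meanXX Q)‖
        + 4 * ‖(n : ℝ)⁻¹ • ∑ j, ξ j • x j‖ + penaltyTerm Q ε S := by
  have h := hR.basic_inequality hε hS
  have hN : ((n : ℝ)⁻¹ • ∑ j, ξ j • x j).IsHermitian :=
    IsSelfAdjoint.smul (IsSelfAdjoint.all _)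
      (isSelfAdjoint_sum _ fun j _ => (hx j).smul (IsSelfAdjoint.all (ξ j)))
  have h1 := (abs_le.mp (re_trace_sub_mul_le hR.1.1 hR.1.2 hS.1 hS.2 hN)).2
  have h2 := (abs_le.mp (abs_empSq_sub_sq_l2Norm_le hn hQ hx hR.1 hS)).1
  have h3 := (abs_le.mp (abs_empSq_sub_sq_l2Norm_le hn hQ hx hR.1 hρ)).1
  have h4 := (abs_le.mp (abs_empSq_sub_sq_l2Norm_le hn hQ hx hS hρ)).2
  have h5 := mul_log_le_penaltyTerm Q hε hS
  linarith

end Deterministic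

/-! ### Fluctuation bounds for the sample -/

section Sample

/-- Two independent families, each of them independent, form an independent family of pairs. -/
lemma iIndepFun_prodMk {Ω ι α β : Type*} [MeasurableSpace Ω] [Fintype ι] [MeasurableSpace α]
    [MeasurableSpace β] {P : Measure Ω} [IsProbabilityMeasure P] {X : ι → Ω → α} {Y : ι → Ω → β}
    (hXm : ∀ j, AEMeasurable (X j) P) (hYm : ∀ j, AEMeasurable (Y j) P) (hX : iIndepFun X P)
    (hY : iIndepFun Y P) (hXY : IndepFun (fun ω j => X j ω) (fun ω j => Y j ω) P) :
    iIndepFun (fun j ω => (X j ω, Y j ω)) P := by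
  have hpm : ∀ j, AEMeasurable (fun ω => (X j ω, Y j ω)) P := fun j => (hXm j).prodMk (hYm j)
  have hXv : AEMeasurable (fun ω j => X j ω) P := aemeasurable_pi_lambda _ hXm
  have hYv : AEMeasurable (fun ω j => Y j ω) P := aemeasurable_pi_lambda _ hYm
  have hPX : ∀ j, IsProbabilityMeasure (P.map (X j)) :=
    fun j => Measure.isProbabilityMeasure_map (hXm j)
  have hPY : ∀ j, IsProbabilityMeasure (P.map (Y j)) :=
    fun j => Measure.isProbabilityMeasure_map (hYm j)
  have hmarg : ∀ j, P.map (fun ω => (X j ω, Y j ω)) = (P.map (X j)).prod (P.map (Y j)) := fun j =>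
    (indepFun_iff_map_prod_eq_prod_map_map (hXm j) (hYm j)).mp
      (hXY.comp (φ := fun v : ι → α => v j) (ψ := fun v : ι → β => v j) (measurable_pi_apply j)
        (measurable_pi_apply j))
  rw [iIndepFun_iff_map_fun_eq_pi_map hpm]
  simp_rw [hmarg]
  let e := MeasurableEquiv.arrowProdEquivProdArrow α β ι
  have hmp := measurePreserving_arrowProdEquivProdArrow α β ι (fun j => P.map (X j))
    (fun j => P.map (Y j))
  have h1 : P.map (fun ω => (fun j => X j ω, fun j => Y j ω))
      = (Measure.pi fun j => P.map (X j)).prod (Measure.pi fun j => P.map (Y j)) := by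
    rw [(indepFun_iff_map_prod_eq_prod_map_map hXv hYv).mp hXY,
      (iIndepFun_iff_map_fun_eq_pi_map hXm).mp hX, (iIndepFun_iff_map_fun_eq_pi_map hYm).mp hY]
  rw [← (hmp.symm e).map_eq, ← h1,
    AEMeasurable.map_map_of_aemeasurable e.symm.measurable.aemeasurable (hXv.prodMk hYv)]
  rfl

variable {m n : ℕ} {Q : Measure (Matrix (Fin m) (Fin m) ℂ)} [IsProbabilityMeasure Q]
  {ν : Measure ℝ} {U c : ℝ}
  {Ω : Type*} [MeasurableSpace Ω] {P : Measure Ω} [IsProbabilityMeasure P]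
  {X : Fin n → Ω → Matrix (Fin m) (Fin m) ℂ} {ξ : Fin n → Ω → ℝ}

/-- `𝔼 X² = 𝔼 (X - 𝔼 X)² + (𝔼 X)²`. -/
lemma norm_integral_sq_le (hQ : ∀ᵐ x ∂Q, x.IsHermitian ∧ ‖x‖ ≤ U) :
    ‖∫ x, x ^ 2 ∂Q‖ ≤ sigmaX Q ^ 2 + ‖meanX Q‖ ^ 2 := by
  have hi : Integrable (fun x : Matrix (Fin m) (Fin m) ℂ => x) Q :=
    .of_bound aestronglyMeasurable_id U (hQ.mono fun x hx => hx.2)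
  have hi2 : Integrable (fun x : Matrix (Fin m) (Fin m) ℂ => x ^ 2) Q := by
    refine .of_bound (continuous_pow 2).aestronglyMeasurable (U ^ 2) ?_
    filter_upwards [hQ] with x hx
    exact (norm_pow_le' _ two_pos).trans (pow_le_pow_left₀ (norm_nonneg _) hx.2 2)
  have e : ∫ x, (x - meanX Q) ^ 2 ∂Q = ∫ x, x ^ 2 ∂Q - meanX Q ^ 2 := by
    have hL : ∫ x, meanX Q * x ∂Q = meanX Q * meanX Q :=
      ((ContinuousLinearMap.mul ℝ _) (meanX Q)).integral_comp_comm hi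
    have hR : ∫ x, x * meanX Q ∂Q = meanX Q * meanX Q :=
      ((ContinuousLinearMap.mul ℝ _).flip (meanX Q)).integral_comp_comm hi
    have h1 : ∀ x : Matrix (Fin m) (Fin m) ℂ,
        (x - meanX Q) ^ 2 = x ^ 2 - (x * meanX Q + meanX Q * x - meanX Q ^ 2) := fun x => by
      noncomm_ring
    have i1 : Integrable (fun x => x * meanX Q + meanX Q * x) Q :=
      (hi.mul_const _).add (hi.const_mul _)
    have i2 : Integrable (fun x => x * meanX Q + meanX Q * x - meanX Q ^ 2) Q :=
      i1.sub (integrable_const _)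
    simp_rw [h1]
    rw [integral_sub hi2 i2, integral_sub i1 (integrable_const _),
      integral_add (hi.mul_const _) (hi.const_mul _), hL, hR]
    simp [sq]
  have h2 : ∫ x, x ^ 2 ∂Q = ∫ x, (x - meanX Q) ^ 2 ∂Q + meanX Q ^ 2 := by rw [e]; abel
  rw [h2, sigmaX, Real.sq_sqrt (norm_nonneg _)]
  exact (norm_add_le _ _).trans (by gcongr; exact norm_pow_le' _ two_pos)

lemma tm_pos (hm : 0 < m) {t : ℝ} (ht : 0 < t) : 0 < tm m t := by
  have : 0 ≤ Real.log (2 * m) := Real.log_nonneg (by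
    have : (1 : ℝ) ≤ m := by exact_mod_cast hm
    linarith)
  unfold tm; linarith

/-- The matrix Bernstein inequality for the noise average `n⁻¹ ∑ ξⱼ Xⱼ`. -/
lemma noise_fluctuation (hm : 0 < m) (hn : 0 < n) (hU : 0 < U)
    (hQ : ∀ᵐ x ∂Q, x.IsHermitian ∧ ‖x‖ ≤ U) (hc : 0 < c) (hν : ∀ᵐ u ∂ν, |u| ≤ c)
    (hν0 : ∫ u, u ∂ν = 0) (hX : ∀ j, HasLaw (X j) Q P) (hXi : iIndepFun X P)
    (hξ : ∀ j, HasLaw (ξ j) ν P) (hξi : iIndepFun ξ P)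
    (hXξ : IndepFun (fun ω j => X j ω) (fun ω j => ξ j ω) P) {T : ℝ} (hT : 0 < T) :
    P.real {ω | 2 * (sigmaXi ν * (sigmaX Q + ‖meanX Q‖)) * √(T / n) + c * U * (T / n)
        < ‖(n : ℝ)⁻¹ • ∑ j, ξ j ω • X j ω‖} ≤ 2 * m * Real.exp (-T) := by
  have : Nonempty (Fin m) := ⟨⟨0, hm⟩⟩
  have hXm := fun j => (hX j).aemeasurable
  have hξm := fun j => (hξ j).aemeasurable
  have hpair : ∀ j, IndepFun (ξ j) (X j) P := fun j =>
    (hXξ.comp (φ := fun v : Fin n → Matrix (Fin m) (Fin m) ℂ => v j)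
      (ψ := fun v : Fin n → ℝ => v j) (measurable_pi_apply j) (measurable_pi_apply j)).symm
  have hsmul : Measurable fun p : Matrix (Fin m) (Fin m) ℂ × ℝ => p.2 • p.1 :=
    measurable_snd.smul measurable_fst
  have hσ0 : 0 ≤ sigmaXi ν * (sigmaX Q + ‖meanX Q‖) := by
    unfold sigmaXi sigmaX; positivity
  have h := matrix_bernstein (P := P) hn (Z := fun j ω => ξ j ω • X j ω)
    (σ := sigmaXi ν * (sigmaX Q + ‖meanX Q‖)) (b := c * U) (T := T) hσ0 (by positivity) hT
    ((iIndepFun_prodMk hXm hξm hXi hξi hXξ).comp (fun _ p => p.2 • p.1) fun _ => hsmul)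
    (fun j => (hξm j).smul (hXm j)) ?_ ?_ ?_
  · simpa using h
  · intro j
    filter_upwards [ae_of_ae_map (hXm j) ((hX j).map_eq ▸ hQ),
      ae_of_ae_map (hξm j) ((hξ j).map_eq ▸ hν)] with ω h1 h2
    refine ⟨h1.1.smul (IsSelfAdjoint.all _), ?_⟩
    rw [norm_smul, Real.norm_eq_abs]
    gcongr
    exact h1.2
  · intro j
    rw [(hpair j).integral_fun_smul_eq_smul_integral (hξm j).aestronglyMeasurable
      (hXm j).aestronglyMeasurable]
    have h0 : ∫ ω, ξ j ω ∂P = 0 := by rw [(hξ j).integral_eq, hν0]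
    rw [h0, zero_smul]
  · intro j
    simp_rw [smul_pow]
    have hind2 : IndepFun (fun ω => ξ j ω ^ 2) (fun ω => X j ω ^ 2) P :=
      (hpair j).comp (φ := fun u : ℝ => u ^ 2) (ψ := fun x => x ^ 2)
        (measurable_id.pow_const 2) (continuous_pow 2).measurable
    rw [hind2.integral_fun_smul_eq_smul_integral ((hξm j).pow_const 2).aestronglyMeasurable
      ((continuous_pow 2).measurable.comp_aemeasurable (hXm j)).aestronglyMeasurable]
    have h1 : ∫ ω, ξ j ω ^ 2 ∂P = sigmaXi ν ^ 2 := by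
      rw [sigmaXi, Real.sq_sqrt (integral_nonneg fun _ => sq_nonneg _)]
      exact (hξ j).integral_comp (f := fun u : ℝ => u ^ 2) (by fun_prop)
    have h2 : ∫ ω, X j ω ^ 2 ∂P = ∫ x, x ^ 2 ∂Q :=
      (hX j).integral_comp (f := fun x => x ^ 2) (continuous_pow 2).aestronglyMeasurable
    rw [h1, h2, norm_smul, norm_pow, Real.norm_eq_abs, sq_abs, mul_pow]
    gcongr
    refine (norm_integral_sq_le hQ).trans ?_
    have h3 : 0 ≤ sigmaX Q := Real.sqrt_nonneg _
    nlinarith [mul_nonneg h3 (norm_nonneg (meanX Q))]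

/-- The matrix Bernstein inequality for `n⁻¹ ∑ (Xⱼ ⊗ Xⱼ - 𝔼 (X ⊗ X))`, in dimension `m²`. -/
lemma tensor_fluctuation (hm : 0 < m) (hn : 0 < n) (hU : 0 < U)
    (hQ : ∀ᵐ x ∂Q, x.IsHermitian ∧ ‖x‖ ≤ U) (hX : ∀ j, HasLaw (X j) Q P) (hXi : iIndepFun X P)
    {T : ℝ} (hT : 0 < T) :
    P.real {ω | 2 * sigmaXX Q * √(T / n) + 2 * U ^ 2 * (T / n)
        < ‖(n : ℝ)⁻¹ • ∑ j, (X j ω ⊗ₖ X j ω - meanXX Q)‖} ≤ 2 * m ^ 2 * Real.exp (-T) := by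
  have : Nonempty (Fin m) := ⟨⟨0, hm⟩⟩
  borelize (Matrix (Fin m × Fin m) (Fin m × Fin m) ℂ)
  have hXm := fun j => (hX j).aemeasurable
  have hcont : Continuous fun x : Matrix (Fin m) (Fin m) ℂ => x ⊗ₖ x - meanXX Q :=
    continuous_kronecker_self.sub continuous_const
  have hi := integrable_kronecker_self hQ
  have hM : (meanXX Q).IsHermitian :=
    integral_isHermitian (hQ.mono fun x hx => isHermitian_kronecker_self hx.1)
  have hMn : ‖meanXX Q‖ ≤ U ^ 2 := by
    have := norm_integral_le_of_norm_le_const (μ := Q)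
      (hQ.mono fun x hx => norm_kronecker_self_le hx.2)
    simpa [meanXX] using this
  have h := matrix_bernstein (P := P) hn (Z := fun j ω => X j ω ⊗ₖ X j ω - meanXX Q)
    (σ := sigmaXX Q) (b := 2 * U ^ 2) (T := T) (Real.sqrt_nonneg _) (by positivity) hT
    (hXi.comp (fun _ x => x ⊗ₖ x - meanXX Q) fun _ => hcont.measurable)
    (fun j => hcont.measurable.comp_aemeasurable (hXm j)) ?_ ?_ ?_
  · simpa [sq] using h
  · intro j
    filter_upwards [ae_of_ae_map (hXm j) ((hX j).map_eq ▸ hQ)] with ω h1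
    refine ⟨(isHermitian_kronecker_self h1.1).sub hM, (norm_sub_le _ _).trans ?_⟩
    linarith [norm_kronecker_self_le h1.2]
  · intro j
    have h1 : ∫ ω, (X j ω ⊗ₖ X j ω - meanXX Q) ∂P = ∫ x, (x ⊗ₖ x - meanXX Q) ∂Q :=
      (hX j).integral_comp (f := fun x => x ⊗ₖ x - meanXX Q) hcont.aestronglyMeasurable
    rw [h1, integral_sub hi (integrable_const _)]
    simp [meanXX]
  · intro j
    have h1 : ∫ ω, (X j ω ⊗ₖ X j ω - meanXX Q) ^ 2 ∂P = ∫ x, (x ⊗ₖ x - meanXX Q) ^ 2 ∂Q :=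
      (hX j).integral_comp (f := fun x => (x ⊗ₖ x - meanXX Q) ^ 2)
        (hcont.pow 2).aestronglyMeasurable
    rw [h1, sigmaXX, Real.sq_sqrt (norm_nonneg _)]

/-- The numerical consequence of the two fluctuation bounds at level `T = 2 t_m`. -/
lemma fluctuation_sum_le {m n : ℕ} {Q : Measure (Matrix (Fin m) (Fin m) ℂ)} {ν : Measure ℝ}
    {U c : ℝ} (hm : 0 < m) {t : ℝ} (ht : 0 < t) {N D : ℝ}
    (hN : N ≤ 2 * (sigmaXi ν * (sigmaX Q + ‖meanX Q‖)) * √(2 * tm m t / n)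
      + c * U * (2 * tm m t / n))
    (hD : D ≤ 2 * sigmaXX Q * √(2 * tm m t / n) + 2 * U ^ 2 * (2 * tm m t / n)) :
    12 * D + 4 * N ≤ 80 * noiseTerm Q ν n t + 56 * boundTerm m c U n t := by
  have hτ : 0 ≤ tm m t / n := by have := tm_pos hm ht; positivity
  set τ := tm m t / n with hτdef
  have e : 2 * tm m t / n = 2 * τ := by rw [hτdef]; ring
  have hr : √(2 * τ) ≤ 2 * √τ := by
    rw [Real.sqrt_le_left (by positivity), mul_pow, Real.sq_sqrt hτ]
    linarith
  rw [e] at hN hD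
  have h0 : 0 ≤ sigmaXi ν := Real.sqrt_nonneg _
  have h1 : 0 ≤ sigmaX Q := Real.sqrt_nonneg _
  have h2 : 0 ≤ sigmaXX Q := Real.sqrt_nonneg _
  rw [noiseTerm, boundTerm, ← hτdef]
  set M := max (max (sigmaXi ν * sigmaX Q) (sigmaXi ν * ‖meanX Q‖)) (sigmaXX Q)
  set B := max (c * U) (U ^ 2)
  have hM1 : sigmaXi ν * sigmaX Q ≤ M := (le_max_left _ _).trans (le_max_left _ _)
  have hM2 : sigmaXi ν * ‖meanX Q‖ ≤ M := (le_max_right _ _).trans (le_max_left _ _)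
  have hM3 : sigmaXX Q ≤ M := le_max_right _ _
  have hB1 : c * U ≤ B := le_max_left _ _
  have hB2 : U ^ 2 ≤ B := le_max_right _ _
  have hN' : N ≤ 2 * (2 * M) * (2 * √τ) + B * (2 * τ) := by
    refine hN.trans ?_
    have h3 : sigmaXi ν * (sigmaX Q + ‖meanX Q‖) ≤ 2 * M := by linarith
    gcongr
  have hD' : D ≤ 2 * M * (2 * √τ) + 2 * B * (2 * τ) := hD.trans (by gcongr)
  linarith

end Sample

end EntropyTomography

/-! ### The oracle inequality with high probability -/

open EntropyTomography in
theorem theorem4 :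
    ∃ C : ℝ, 0 < C ∧
      ∀ (m n : ℕ), 0 < n →
      -- the laws of the design matrix and of the noise
      ∀ (Q : Measure (Matrix (Fin m) (Fin m) ℂ)) [IsProbabilityMeasure Q]
        (ν : Measure ℝ) [IsProbabilityMeasure ν] (U c : ℝ),
      0 < U → (∀ᵐ x ∂Q, x.IsHermitian ∧ ‖x‖ ≤ U) →
      0 < c → (∀ᵐ u ∂ν, |u| ≤ c) → ∫ u, u ∂ν = 0 →
      -- the sample: independent design matrices, independent noise, design independent of noise
      ∀ {Ω : Type*} [MeasurableSpace Ω] (P : Measure Ω) [IsProbabilityMeasure P]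
        (X : Fin n → Ω → Matrix (Fin m) (Fin m) ℂ) (ξ : Fin n → Ω → ℝ),
      (∀ j, HasLaw (X j) Q P) → iIndepFun X P →
      (∀ j, HasLaw (ξ j) ν P) → iIndepFun ξ P →
      IndepFun (fun ω j => X j ω) (fun ω j => ξ j ω) P →
      ∀ ρ ∈ EntropyTomography.states m, ∀ ε : ℝ, 0 ≤ ε → ∀ t : ℝ, 0 < t →
      ∀ ρhat : Ω → Matrix (Fin m) (Fin m) ℂ,
      (∀ᵐ ω ∂P, EntropyTomography.IsEstimate (fun j => X j ω)
        (fun j => (ρ * X j ω).trace.re + ξ j ω) ε (ρhat ω)) →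
      (∀ S ∈ EntropyTomography.states m,
        ∃ A : Set Ω, MeasurableSet A ∧ 1 - Real.exp (-t) ≤ P.real A ∧ ∀ ω ∈ A,
          EntropyTomography.l2Norm Q (ρhat ω - S) ^ 2 ≤
            EntropyTomography.l2Norm Q (S - ρ) ^ 2 +
              C * max (max (max
                (EntropyTomography.penaltyTerm Q ε S)
                (EntropyTomography.l2Norm Q (S - ρ) * U * √(EntropyTomography.tm m t / n)))
                (EntropyTomography.noiseTerm Q ν n t))
                (EntropyTomography.boundTerm m c U n t) ∧
          EntropyTomography.l2Norm Q (ρhat ω - ρ) ^ 2 ≤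
            EntropyTomography.l2Norm Q (S - ρ) ^ 2 +
              C * max (max (max
                (EntropyTomography.penaltyTerm Q ε S)
                (EntropyTomography.l2Norm Q (S - ρ) * U * √(EntropyTomography.tm m t / n)))
                (EntropyTomography.noiseTerm Q ν n t))
                (EntropyTomography.boundTerm m c U n t)) ∧
      (∃ A : Set Ω, MeasurableSet A ∧ 1 - Real.exp (-t) ≤ P.real A ∧ ∀ ω ∈ A,
        EntropyTomography.l2Norm Q (ρhat ω - ρ) ^ 2 ≤
          C * max (max
            (EntropyTomography.penaltyTerm Q ε ρ)
            (EntropyTomography.noiseTerm Q ν n t))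
            (EntropyTomography.boundTerm m c U n t)) := by
  refine ⟨140, by norm_num, ?_⟩
  intro m n hn Q _ ν _ U c hU hQ hc hν hν0 Ω _ P _ X ξ hX hXi hξ hξi hXξ ρ hρ ε hε t ht ρhat hest

  have hm : 0 < m := pos_of_mem_states hρ
  have htm := tm_pos hm ht
  have hT : 0 < 2 * tm m t := by positivity
  -- one event serves all oracles `S`
  set BN := {ω | 2 * (sigmaXi ν * (sigmaX Q + ‖meanX Q‖)) * √(2 * tm m t / n)
    + c * U * (2 * tm m t / n) < ‖(n : ℝ)⁻¹ • ∑ j, ξ j ω • X j ω‖} with hBN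
  set BD := {ω | 2 * sigmaXX Q * √(2 * tm m t / n) + 2 * U ^ 2 * (2 * tm m t / n)
    < ‖(n : ℝ)⁻¹ • ∑ j, (X j ω ⊗ₖ X j ω - meanXX Q)‖} with hBD
  set Good := {ω | (∀ j, (X j ω).IsHermitian) ∧ IsEstimate (fun j => X j ω)
    (fun j => (ρ * X j ω).trace.re + ξ j ω) ε (ρhat ω)} with hGood
  have hGoodP : P.real Goodᶜ = 0 := by
    have h : ∀ᵐ ω ∂P, ω ∈ Good := by
      filter_upwards [hest, Filter.eventually_all.mpr fun j =>
        ae_of_ae_map (hX j).aemeasurable ((hX j).map_eq ▸ hQ)] with ω h1 h2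
      exact ⟨fun j => (h2 j).1, h1⟩
    exact congrArg ENNReal.toReal (ae_iff.mp h)
  have hPN : P.real BN ≤ _ := noise_fluctuation hm hn hU hQ hc hν hν0 hX hXi hξ hξi hXξ hT
  have hPD : P.real BD ≤ _ := tensor_fluctuation hm hn hU hQ hX hXi hT
  set B := BN ∪ BD ∪ Goodᶜ
  -- the level `2 t_m` also pays for the dimension `m²` of `X ⊗ X`
  have hexp : Real.exp (-(2 * tm m t)) = Real.exp (-(2 * t)) / (2 * m) ^ 2 := by
    have h2m : (0 : ℝ) < 2 * m := by positivity
    rw [tm, eq_div_iff (by positivity), ← Real.exp_log (pow_pos h2m 2), Real.log_pow,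
      ← Real.exp_add]
    congr 1
    push_cast
    ring
  have hPB : P.real B ≤ Real.exp (-t) := by
    have hm1 : (1 : ℝ) ≤ m := by exact_mod_cast hm
    calc P.real B ≤ P.real BN + P.real BD + P.real Goodᶜ :=
          (measureReal_union_le _ _).trans (by gcongr; exact measureReal_union_le _ _)
      _ ≤ 2 * m * Real.exp (-(2 * tm m t)) + 2 * m ^ 2 * Real.exp (-(2 * tm m t)) + 0 := by
          gcongr
          exact hGoodP.le
      _ = (2 * m + 2 * m ^ 2) / (2 * m) ^ 2 * Real.exp (-(2 * t)) := by rw [hexp]; ring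
      _ ≤ 1 * Real.exp (-t) := by
          gcongr
          · rw [div_le_one (by positivity)]
            nlinarith
          · linarith
      _ = _ := one_mul _
  -- `ρhat` need not be measurable, so the bad event is replaced by its measurable hull
  set A := (toMeasurable P B)ᶜ with hA
  have hAm : MeasurableSet A := (measurableSet_toMeasurable P B).compl
  have hAP : 1 - Real.exp (-t) ≤ P.real A := by
    rw [hA, probReal_compl_eq_one_sub (measurableSet_toMeasurable P B), measureReal_def,
      measure_toMeasurable]
    exact sub_le_sub_left hPB 1
  have key : ∀ S ∈ states m, ∀ ω ∈ A,
      l2Norm Q (ρhat ω - S) ^ 2 + l2Norm Q (ρhat ω - ρ) ^ 2 ≤ l2Norm Q (S - ρ) ^ 2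
        + 140 * max (max (penaltyTerm Q ε S) (noiseTerm Q ν n t)) (boundTerm m c U n t) := by
    intro S hS ω hω
    have hωB : ω ∉ B := fun h => hω (subset_toMeasurable P B h)
    have h1 : ω ∉ BN := fun h => hωB (Or.inl (Or.inl h))
    have h2 : ω ∉ BD := fun h => hωB (Or.inl (Or.inr h))
    have h3 : ω ∈ Good := by
      by_contra h
      exact hωB (Or.inr h)
    have h4 := h3.2.oracle_inequality hn hQ h3.1 hε hρ hS
    have h5 := fluctuation_sum_le (Q := Q) (ν := ν) hm ht (not_lt.mp h1) (not_lt.mp h2)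
    set M := max (max (penaltyTerm Q ε S) (noiseTerm Q ν n t)) (boundTerm m c U n t)
    have m1 : penaltyTerm Q ε S ≤ M := (le_max_left _ _).trans (le_max_left _ _)
    have m2 : noiseTerm Q ν n t ≤ M := (le_max_right _ _).trans (le_max_left _ _)
    have m3 : boundTerm m c U n t ≤ M := le_max_right _ _
    have hb0 : 0 ≤ boundTerm m c U n t := by unfold boundTerm; positivity
    linarith
  refine ⟨fun S hS => ⟨A, hAm, hAP, fun ω hω => ?_⟩, A, hAm, hAP, fun ω hω => ?_⟩
  · have h := key S hS ω hω
    have hle : max (max (penaltyTerm Q ε S) (noiseTerm Q ν n t)) (boundTerm m c U n t)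
        ≤ max (max (max (penaltyTerm Q ε S) (l2Norm Q (S - ρ) * U * √(tm m t / n)))
          (noiseTerm Q ν n t)) (boundTerm m c U n t) := by
      gcongr
      exact le_max_left _ _
    have h1 := sq_nonneg (l2Norm Q (ρhat ω - S))
    have h2 := sq_nonneg (l2Norm Q (ρhat ω - ρ))
    constructor <;> linarith
  · have h := key ρ hρ ω hω
    have h0 : l2Norm Q (ρ - ρ) = 0 := by simp [l2Norm, hsInner]
    rw [h0] at h
    have h2 := sq_nonneg (l2Norm Q (ρhat ω - ρ))
    linarith
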